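/- Let $d\ge 1$ be an integer and let $X=\{X_k\}_{k\ge 1}$ be an admissible sequence: $X_k\in B((\mathbb{C}^d)^{\otimes k})$, $X_k\ge 0$ for all $k$, $X_1$ is invertible, and $\limsup_k\|X_k\|^{1/k}<\infty$. Put $R_0=I$ and, for $k\ge1$, $$R_k=\Big(\sum_{l=1}^k\ \sum_{k_1+\cdots+k_l=k,\ k_i\ge 1} X_{k_1}\otimes\cdots\otimes X_{k_l}\Big)^{1/2},$$ and let $\mathcal F(\mathcal R)=\bigoplus_{k\ge0}R_k(\mathbb{C}^d)^{\circledS k}$, a closed subspace of the full Fock space $\bigoplus_{k\ge 0}(\mathbb{C}^d)^{\otimes k}$, where $(\mathbb{C}^d)^{\circledS k}$ denotes the symmetric tensors. Inner products are linear in the second variable. Let $H\neq 0$ be a complex Hilbert space. For a tuple $T=(T_1,\dots,T_d)$ in $B(H)$ let $T^{(k)}=(T_\alpha)_{|\alpha|=k}:(\mathbb{C}^d)^{\otimes k}\otimes H\to H$ be the row of all products $T_\alpha=T_{\alpha(1)}\cdots T_{\alpha(k)}$. Let $D_c(X,H)$ be the set of commuting tuples $T$ for which $\Phi_T(I)=\sum_{k\ge1}T^{(k)}(X_k\otimes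 I)T^{(k)*}$ converges weak-* and $\|\Phi_T(I)\|<1$. For $V,W\in D_c(X,H)$ and $a\in B(H)$ let $$K^R_c(V,W)(a)=\sum_{k=0}^\infty V^{(k)}(R_k^2\otimes a)W^{(k)*}\qquad\text{(in the weak operator topology)}.$$ A kernel $K$ on a set $\Omega$ with values in the normal bounded linear maps on $B(H)$ is called completely positive if for all $z_1,\dots,z_n\in \Omega$ the map $(a_{ij})\mapsto(K(z_i,z_j)(a_{ij}))$ on $M_n(B(H))$ is completely positive. For such a $K$, $E_K$ denotes the $W^*$-correspondence over $B(H)$ generated, as a right $W^*$-module over $B(H)$, by elements $k_{(a,w)}$ ($a\in B(H)$, $w\in \Omega$) with $\langle k_{(b,z)},k_{(a,w)}\rangle=K(z,w)(ba^*)$ and left action $b\cdot k_{(a,w)}=k_{(ab^*,w)}$. Let $\sigma$ be the identity representation of $B(H)$ on $H$. For a $W^*$-correspondence $F$ over $B(H)$ with left action $\varphi_F$, its $\sigma$-dual is $$F^\sigma=\{Y\in B(H,F\otimes_\sigma H):\ Y\sigma(b)=(\varphi_F(b)\otimes I_H)Y\ \text{ for all } b\in B(H)\},\qquad \langle Y_1,Y_2\rangle=Y_1^*Y_2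 .$$ Then the series defining $K^R_c$ converge, $K^R_c$ is a completely positive kernel on $D_c(X,H)$, and $E_{K^R_c}^\sigma$ is isomorphic as a Hilbert space to $\mathcal F(\mathcal R)$: there is a linear bijection $\Psi:\mathcal F(\mathcal R)\to E_{K^R_c}^\sigma$ with $\Psi(\xi)^*\Psi(\eta)=\langle\xi,\eta\rangle I_H$ for all $\xi,\eta\in\mathcal F(\mathcal R)$. -/

import Mathlib

open scoped InnerProductSpace ComplexOrder
open UniformSpace
open ContinuousLinearMapWOT (ofCLM toCLM)
set_option linter.unusedSectionVars false
set_option linter.unusedSimpArgs false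

noncomputable section

universe u v

namespace RKC

variable {H : Type u} [NormedAddCommGroup H] [InnerProductSpace ℂ H] [CompleteSpace H]

/-- Positivity of a finite operator matrix `A ∈ M_ι(B(H))`, i.e. of the operator it defines on the
direct sum of copies of `H`. -/
def BlockPos {ι : Type*} [Fintype ι] (A : ι → ι → (H →L[ℂ] H)) : Prop :=
  ∀ x : ι → H, 0 ≤ ∑ i, ∑ j, ⟪x i, A i j (x j)⟫_ℂ

/-- Normal (weak-* continuous) bounded linear maps on `B(H)`.  On norm-bounded sets the weak-*
topology of `B(H)` is the weak operator topology, and a bounded linear map is weak-* continuous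
iff it is so on norm-bounded sets. -/
def IsNormalMap (φ : (H →L[ℂ] H) → (H →L[ℂ] H)) : Prop :=
  IsBoundedLinearMap ℂ φ ∧
    ∀ r : ℝ, ContinuousOn (fun a : H →WOT[ℂ] H => ofCLM (φ (toCLM a)))
      {a : H →WOT[ℂ] H | ‖toCLM a‖ ≤ r}

/-! ### The Hilbert space of a positive definite operator-valued kernel -/

section Kolmogorov

variable {S : Type v} {κ : S → S → (H →L[ℂ] H)}

/-- Positive definite `B(H)`-valued kernels on a set `S`. -/
def PosDefKernel (κ : S → S → (H →L[ℂ] H)) : Prop :=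
  ∀ (n : ℕ) (s : Fin n → S), BlockPos fun i j => κ (s i) (s j)

/-- The sesquilinear form `⟨s ⊗ h, t ⊗ k⟩ = ⟪h, κ(s,t) k⟫` on finitely supported functions, where
`s ⊗ h` is `Finsupp.single s h`. -/
def kform (κ : S → S → (H →L[ℂ] H)) (f g : S →₀ H) : ℂ :=
  f.sum fun s h => g.sum fun t k => ⟪h, κ s t k⟫_ℂ

lemma kform_add_left (f f' g : S →₀ H) : kform κ (f + f') g = kform κ f g + kform κ f' g := by
  classical
  refine Finsupp.sum_add_index' (fun s => by simp) (fun s h h' => ?_)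
  simp [inner_add_left, Finsupp.sum_add]

lemma kform_add_right (f g g' : S →₀ H) : kform κ f (g + g') = kform κ f g + kform κ f g' := by
  classical
  unfold kform
  rw [← Finsupp.sum_add]
  refine Finsupp.sum_congr fun s _ => ?_
  exact Finsupp.sum_add_index' (fun s => by simp) (fun s h h' => by simp [inner_add_right])

lemma kform_smul_left (c : ℂ) (f g : S →₀ H) :
    kform κ (c • f) g = (starRingEnd ℂ) c * kform κ f g := by
  unfold kform
  rw [Finsupp.sum_smul_index' (fun s => by simp)]
  simp only [Finsupp.sum, Finset.mul_sum, inner_smul_left]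

lemma kform_smul_right (c : ℂ) (f g : S →₀ H) :
    kform κ f (c • g) = c * kform κ f g := by
  unfold kform
  simp_rw [fun s h => Finsupp.sum_smul_index' (g := g) (b := c)
    (h := fun t k => ⟪h, κ s t k⟫_ℂ) (fun t => by simp)]
  simp only [Finsupp.sum, Finset.mul_sum, map_smul, inner_smul_right]

lemma kform_single (s t : S) (h k : H) :
    kform κ (Finsupp.single s h) (Finsupp.single t k) = ⟪h, κ s t k⟫_ℂ := by
  simp [kform]

lemma kform_self_nonneg (hκ : PosDefKernel κ) (f : S →₀ H) : 0 ≤ kform κ f f := by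
  classical
  have e := f.support.equivFin.symm
  have h := hκ f.support.card (fun i => (e i : S)) (fun i => f (e i))
  have h2 : kform κ f f = ∑ i, ∑ j, ⟪f (e i), κ (e i) (e j) (f (e j))⟫_ℂ := by
    rw [e.sum_comp (fun s : f.support => ∑ j, ⟪f s, κ s (e j) (f (e j))⟫_ℂ)]
    simp_rw [fun s : f.support => e.sum_comp (fun t : f.support => ⟪f s, κ s t (f t)⟫_ℂ)]
    unfold kform Finsupp.sum
    rw [← Finset.sum_coe_sort f.support]
    refine Finset.sum_congr rfl fun s _ => ?_
    exact (Finset.sum_coe_sort f.support (fun t => ⟪f s, κ s t (f t)⟫_ℂ)).symm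
  rw [h2]; exact h

lemma kform_conj (hκ : PosDefKernel κ) (f g : S →₀ H) :
    (starRingEnd ℂ) (kform κ g f) = kform κ f g := by
  have h1 := (Complex.nonneg_iff.mp (kform_self_nonneg hκ f)).2
  have h2 := (Complex.nonneg_iff.mp (kform_self_nonneg hκ g)).2
  have h3 := (Complex.nonneg_iff.mp (kform_self_nonneg hκ (f + g))).2
  have h4 := (Complex.nonneg_iff.mp (kform_self_nonneg hκ (f + Complex.I • g))).2
  simp only [kform_add_left, kform_add_right, kform_smul_left, kform_smul_right, Complex.add_im,
    Complex.conj_I, Complex.mul_im, Complex.add_re, Complex.mul_re, Complex.I_re, Complex.I_im,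
    Complex.neg_im, Complex.neg_re] at h3 h4
  apply Complex.ext
  · rw [Complex.conj_re]; linarith
  · rw [Complex.conj_im]; linarith

/-- Finitely supported functions `S → H` with the semi-inner product of the kernel. -/
@[nolint unusedArguments]
def KPre {κ : S → S → (H →L[ℂ] H)} (_ : PosDefKernel κ) : Type (max u v) := S →₀ H

instance (hκ : PosDefKernel κ) : AddCommGroup (KPre hκ) := inferInstanceAs (AddCommGroup (S →₀ H))
instance (hκ : PosDefKernel κ) : Module ℂ (KPre hκ) := inferInstanceAs (Module ℂ (S →₀ H))

/-- The semi-inner product of a positive definite kernel. -/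
abbrev kcore (hκ : PosDefKernel κ) : PreInnerProductSpace.Core ℂ (KPre hκ) where
  inner f g := kform κ f g
  conj_inner_symm f g := kform_conj hκ f g
  re_inner_nonneg f := (Complex.nonneg_iff.mp (kform_self_nonneg hκ f)).1
  add_left f g h := kform_add_left f g h
  smul_left f g c := kform_smul_left c f g

instance (hκ : PosDefKernel κ) : SeminormedAddCommGroup (KPre hκ) :=
  InnerProductSpace.Core.toSeminormedAddCommGroup (c := kcore hκ)
instance (hκ : PosDefKernel κ) : InnerProductSpace ℂ (KPre hκ) :=
  InnerProductSpace.ofCore (kcore hκ)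

lemma kpre_inner (hκ : PosDefKernel κ) (f g : KPre hκ) : ⟪f, g⟫_ℂ = kform κ f g := rfl

/-- The Hilbert space generated by vectors `s ⊗ h` (`s ∈ S`, `h ∈ H`) with
`⟪s ⊗ h, t ⊗ k⟫ = ⟪h, κ(s,t) k⟫`: separated completion of the finitely supported functions. -/
abbrev KSpace (hκ : PosDefKernel κ) : Type (max u v) := Completion (KPre hκ)

/-- `s ⊗ h` before completion, linear in `h`. -/
def kpreVec (hκ : PosDefKernel κ) (s : S) : H →ₗ[ℂ] KPre hκ := Finsupp.lsingle (R := ℂ) s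

lemma kpre_inner_vec (hκ : PosDefKernel κ) (s t : S) (h k : H) :
    ⟪kpreVec hκ s h, kpreVec hκ t k⟫_ℂ = ⟪h, κ s t k⟫_ℂ := by
  rw [kpre_inner]; exact kform_single s t h k

/-- The bounded operator `h ↦ s ⊗ h`. -/
def kvec (hκ : PosDefKernel κ) (s : S) : H →L[ℂ] KSpace hκ :=
  (Completion.toComplL (𝕜 := ℂ) (E := KPre hκ)).comp
    ((kpreVec hκ s).mkContinuous (√‖κ s s‖) fun h => by
      refine (sq_le_sq₀ (norm_nonneg _) (by positivity)).mp ?_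
      rw [mul_pow, Real.sq_sqrt (norm_nonneg _), ← inner_self_eq_norm_sq (𝕜 := ℂ), kpre_inner_vec]
      calc RCLike.re ⟪h, κ s s h⟫_ℂ ≤ ‖⟪h, κ s s h⟫_ℂ‖ := RCLike.re_le_norm _
        _ ≤ ‖h‖ * ‖κ s s h‖ := norm_inner_le_norm _ _
        _ ≤ ‖h‖ * (‖κ s s‖ * ‖h‖) := by gcongr; exact (κ s s).le_opNorm h
        _ = ‖κ s s‖ * ‖h‖ ^ 2 := by ring)

lemma kvec_apply (hκ : PosDefKernel κ) (s : S) (h : H) :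
    kvec hκ s h = ((kpreVec hκ s h : KPre hκ) : KSpace hκ) := rfl

lemma inner_kvec (hκ : PosDefKernel κ) (s t : S) (h k : H) :
    ⟪kvec hκ s h, kvec hκ t k⟫_ℂ = ⟪h, κ s t k⟫_ℂ := by
  rw [kvec_apply, kvec_apply, Completion.inner_coe, kpre_inner_vec]

/-- A closed property of vectors that holds on sums of elementary vectors holds everywhere. -/
lemma kspace_span (hκ : PosDefKernel κ) (N : Submodule ℂ (KSpace hκ))
    (hN : IsClosed (N : Set (KSpace hκ))) (h : ∀ s x, kvec hκ s x ∈ N) (g : KSpace hκ) : g ∈ N := by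
  induction g using Completion.induction_on with
  | hp => exact hN
  | ih f =>
    induction f using Finsupp.induction_linear with
    | zero => exact N.zero_mem
    | add f g hf hg =>
      have := N.add_mem hf hg
      exact (Completion.coe_add (α := KPre hκ) f g).symm ▸ this
    | single s x => exact h s x

lemma kspace_ext (hκ : PosDefKernel κ) (g g' : KSpace hκ)
    (h : ∀ s x, ⟪kvec hκ s x, g⟫_ℂ = ⟪kvec hκ s x, g'⟫_ℂ) : g = g' := by
  refine ext_inner_left ℂ fun y => ?_
  let N : Submodule ℂ (KSpace hκ) := (LinearMap.ker (innerSL ℂ (g - g')).toLinearMap)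
  have : y ∈ N := by
    refine kspace_span hκ N ?_ (fun s x => ?_) y
    · exact (innerSL ℂ (g - g')).isClosed_ker
    · have : ⟪kvec hκ s x, g - g'⟫_ℂ = 0 := by rw [inner_sub_right, h, sub_self]
      exact inner_eq_zero_symm.mp this
  have h2 : ⟪g - g', y⟫_ℂ = 0 := this
  have h3 := inner_eq_zero_symm.mp h2
  rwa [inner_sub_right, sub_eq_zero] at h3

/-- `b ↦ θ_b` is an action of `B(H)` on `S` for which `κ` is a normal *-invariant kernel. -/
structure KAction (κ : S → S → (H →L[ℂ] H)) (θ : (H →L[ℂ] H) → S → S) : Prop where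
  one : ∀ s, θ 1 s = s
  mul : ∀ a b s, θ (a * b) s = θ a (θ b s)
  adj : ∀ b s t, κ (θ b s) t = κ s (θ (star b) t)
  normal : ∀ s t, IsNormalMap fun b => κ s (θ b t)

variable {θ : (H →L[ℂ] H) → S → S}

/-- `s ⊗ h ↦ θ_b(s) ⊗ h` on finitely supported functions. -/
def kactPre (hκ : PosDefKernel κ) (θ : (H →L[ℂ] H) → S → S) (b : H →L[ℂ] H) :
    KPre hκ →ₗ[ℂ] KPre hκ := Finsupp.lmapDomain H ℂ (θ b)

lemma kactPre_vec (hκ : PosDefKernel κ) (b : H →L[ℂ] H) (s : S) (h : H) :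
    kactPre hκ θ b (kpreVec hκ s h) = kpreVec hκ (θ b s) h :=
  Finsupp.mapDomain_single

lemma kform_map_right (τ : S → S) (f g : S →₀ H) :
    kform κ f (Finsupp.mapDomain τ g) = kform (fun s t => κ s (τ t)) f g := by
  unfold kform
  refine Finsupp.sum_congr fun s _ => ?_
  exact Finsupp.sum_mapDomain_index (fun t => by simp) (fun t k k' => by simp [inner_add_right])

lemma kform_map_left (τ : S → S) (f g : S →₀ H) :
    kform κ (Finsupp.mapDomain τ f) g = kform (fun s t => κ (τ s) t) f g := by
  unfold kform
  refine Finsupp.sum_mapDomain_index (fun t => by simp [Finsupp.sum]) (fun t k k' => ?_)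
  simp [Finsupp.sum, inner_add_left, Finset.sum_add_distrib]

lemma inner_kactPre (hκ : PosDefKernel κ) (b : H →L[ℂ] H) (f g : KPre hκ) :
    ⟪f, kactPre hκ θ b g⟫_ℂ = kform (fun s t => κ s (θ b t)) f g := kform_map_right _ f g

lemma kactPre_adj (hκ : PosDefKernel κ) (hθ : KAction κ θ) (b : H →L[ℂ] H) (f g : KPre hκ) :
    ⟪kactPre hκ θ b f, g⟫_ℂ = ⟪f, kactPre hκ θ (star b) g⟫_ℂ := by
  rw [inner_kactPre]
  refine (kform_map_left _ f g).trans ?_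
  simp_rw [hθ.adj]

lemma kactPre_mul (hκ : PosDefKernel κ) (hθ : KAction κ θ) (a b : H →L[ℂ] H) (f : KPre hκ) :
    kactPre hκ θ (a * b) f = kactPre hκ θ a (kactPre hκ θ b f) := by
  have : θ (a * b) = θ a ∘ θ b := funext fun s => hθ.mul a b s
  show Finsupp.mapDomain _ _ = Finsupp.mapDomain _ (Finsupp.mapDomain _ _)
  rw [this]; exact Finsupp.mapDomain_comp

lemma kactPre_one (hκ : PosDefKernel κ) (hθ : KAction κ θ) (f : KPre hκ) :
    kactPre hκ θ 1 f = f := by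
  have : θ 1 = id := funext fun s => hθ.one s
  show Finsupp.mapDomain _ _ = _
  rw [this]; exact Finsupp.mapDomain_id

lemma inner_kactPre_sub (hκ : PosDefKernel κ) (hθ : KAction κ θ) (a b : H →L[ℂ] H)
    (f g : KPre hκ) :
    ⟪f, kactPre hκ θ (a - b) g⟫_ℂ = ⟪f, kactPre hκ θ a g⟫_ℂ - ⟪f, kactPre hκ θ b g⟫_ℂ := by
  have h : ∀ s t, κ s (θ (a - b) t) = κ s (θ a t) - κ s (θ b t) := fun s t =>
    (hθ.normal s t).1.toIsLinearMap.map_sub a b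
  simp [inner_kactPre, kform, Finsupp.sum, h, inner_sub_right]

lemma inner_kactPre_smul (hκ : PosDefKernel κ) (hθ : KAction κ θ) (c : ℂ) (a : H →L[ℂ] H)
    (f g : KPre hκ) :
    ⟪f, kactPre hκ θ (c • a) g⟫_ℂ = c * ⟪f, kactPre hκ θ a g⟫_ℂ := by
  have h : ∀ s t, κ s (θ (c • a) t) = c • κ s (θ a t) := fun s t =>
    (hθ.normal s t).1.toIsLinearMap.map_smul c a
  simp [inner_kactPre, kform, Finsupp.sum, h, inner_smul_right, Finset.mul_sum]

lemma kactPre_norm_le (hκ : PosDefKernel κ) (hθ : KAction κ θ) (b : H →L[ℂ] H) (f : KPre hκ) :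
    ‖kactPre hκ θ b f‖ ≤ ‖b‖ * ‖f‖ := by
  have hle : star b * b ≤ algebraMap ℝ (H →L[ℂ] H) (‖b‖ ^ 2) := by
    have := IsSelfAdjoint.le_algebraMap_norm_self (IsSelfAdjoint.star_mul_self b)
    rwa [CStarRing.norm_star_mul_self, ← sq] at this
  obtain ⟨c, hc⟩ := CStarAlgebra.nonneg_iff_eq_star_mul_self.mp (sub_nonneg.mpr hle)
  have hc' : star c * c = ((‖b‖ ^ 2 : ℝ) : ℂ) • (1 : H →L[ℂ] H) - star b * b := by
    rw [← hc, Algebra.algebraMap_eq_smul_one, Complex.coe_smul]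
  have key : ∀ d : H →L[ℂ] H,
      ⟪f, kactPre hκ θ (star d * d) f⟫_ℂ = ((‖kactPre hκ θ d f‖ ^ 2 : ℝ) : ℂ) := fun d => by
    rw [kactPre_mul hκ hθ, ← kactPre_adj hκ hθ]
    simp
  have h1 := key c
  have h0 := key 1
  rw [star_one, one_mul, kactPre_one hκ hθ] at h0
  rw [hc', inner_kactPre_sub hκ hθ, inner_kactPre_smul hκ hθ, key b, kactPre_one hκ hθ, h0] at h1
  have h2 : ‖b‖ ^ 2 * ‖f‖ ^ 2 - ‖kactPre hκ θ b f‖ ^ 2 = ‖kactPre hκ θ c f‖ ^ 2 := by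
    exact_mod_cast h1
  refine (sq_le_sq₀ (norm_nonneg _) (by positivity)).mp ?_
  rw [mul_pow]
  nlinarith [sq_nonneg ‖kactPre hκ θ c f‖]

/-- The bounded operator on the Hilbert space of the kernel with `s ⊗ h ↦ θ_b(s) ⊗ h`. -/
def kact (hκ : PosDefKernel κ) (hθ : KAction κ θ) (b : H →L[ℂ] H) :
    KSpace hκ →L[ℂ] KSpace hκ :=
  ((kactPre hκ θ b).mkContinuous ‖b‖ (kactPre_norm_le hκ hθ b)).completion

lemma kact_coe (hκ : PosDefKernel κ) (hθ : KAction κ θ) (b : H →L[ℂ] H) (f : KPre hκ) :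
    kact hκ hθ b (f : KSpace hκ) = ((kactPre hκ θ b f : KPre hκ) : KSpace hκ) :=
  ContinuousLinearMap.completion_apply_coe _ _

lemma kact_kvec (hκ : PosDefKernel κ) (hθ : KAction κ θ) (b : H →L[ℂ] H) (s : S) (h : H) :
    kact hκ hθ b (kvec hκ s h) = kvec hκ (θ b s) h := by
  rw [kvec_apply, kact_coe, kactPre_vec, kvec_apply]

lemma kact_norm_le (hκ : PosDefKernel κ) (hθ : KAction κ θ) (b : H →L[ℂ] H) (g : KSpace hκ) :
    ‖kact hκ hθ b g‖ ≤ ‖b‖ * ‖g‖ := by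
  induction g using Completion.induction_on with
  | hp => exact isClosed_le (by fun_prop) (by fun_prop)
  | ih f =>
    rw [kact_coe, Completion.norm_coe, Completion.norm_coe]
    exact kactPre_norm_le hκ hθ b f

lemma kact_adj (hκ : PosDefKernel κ) (hθ : KAction κ θ) (b : H →L[ℂ] H) (g g' : KSpace hκ) :
    ⟪kact hκ hθ b g, g'⟫_ℂ = ⟪g, kact hκ hθ (star b) g'⟫_ℂ := by
  induction g, g' using Completion.induction_on₂ with
  | hp => exact isClosed_eq (by fun_prop) (by fun_prop)
  | ih f f' =>
    rw [kact_coe, kact_coe, Completion.inner_coe, Completion.inner_coe, kactPre_adj hκ hθ]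

lemma kact_one (hκ : PosDefKernel κ) (hθ : KAction κ θ) : kact hκ hθ 1 = 1 := by
  ext g
  induction g using Completion.induction_on with
  | hp => exact isClosed_eq (by fun_prop) (by fun_prop)
  | ih f => rw [kact_coe, kactPre_one hκ hθ]; rfl

lemma kact_mul (hκ : PosDefKernel κ) (hθ : KAction κ θ) (a b : H →L[ℂ] H) :
    kact hκ hθ (a * b) = kact hκ hθ a * kact hκ hθ b := by
  ext g
  induction g using Completion.induction_on with
  | hp => exact isClosed_eq (by fun_prop) (by fun_prop)
  | ih f =>
    rw [mul_apply_eq_comp, kact_coe, kact_coe, kact_coe, kactPre_mul hκ hθ]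

lemma kact_add (hκ : PosDefKernel κ) (hθ : KAction κ θ) (a b : H →L[ℂ] H) :
    kact hκ hθ (a + b) = kact hκ hθ a + kact hκ hθ b := by
  ext g
  refine kspace_ext hκ _ _ fun s x => ?_
  rw [add_apply, inner_add_right]
  have h : ∀ c, ⟪kvec hκ s x, kact hκ hθ c g⟫_ℂ = ⟪kvec hκ (θ (star c) s) x, g⟫_ℂ := fun c => by
    rw [← kact_kvec hκ hθ, kact_adj, star_star]
  rw [h, h, h]
  clear h
  induction g using Completion.induction_on with
  | hp => apply isClosed_eq <;> fun_prop
  | ih f =>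
    have := inner_kactPre_sub hκ hθ (a + b) b (kpreVec hκ s x) f
    rw [add_sub_cancel_right] at this
    simp only [kvec_apply, Completion.inner_coe]
    simp only [← kactPre_vec, kactPre_adj hκ hθ, star_star]
    rw [this]; ring

lemma kact_smul (hκ : PosDefKernel κ) (hθ : KAction κ θ) (c : ℂ) (a : H →L[ℂ] H) :
    kact hκ hθ (c • a) = c • kact hκ hθ a := by
  ext g
  refine kspace_ext hκ _ _ fun s x => ?_
  rw [smul_apply, inner_smul_right]
  have h : ∀ c, ⟪kvec hκ s x, kact hκ hθ c g⟫_ℂ = ⟪kvec hκ (θ (star c) s) x, g⟫_ℂ := fun c => by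
    rw [← kact_kvec hκ hθ, kact_adj, star_star]
  rw [h, h]
  clear h
  induction g using Completion.induction_on with
  | hp => apply isClosed_eq <;> fun_prop
  | ih f =>
    simp only [kvec_apply, Completion.inner_coe]
    simp only [← kactPre_vec, kactPre_adj hκ hθ, star_star]
    exact inner_kactPre_smul hκ hθ c a _ f

/-- The representation `b ↦ kact b` is weak operator continuous on bounded sets. -/
lemma kact_normal (hκ : PosDefKernel κ) (hθ : KAction κ θ) (r : ℝ) (g g' : KSpace hκ) :
    ContinuousOn (fun a : H →WOT[ℂ] H => ⟪g, kact hκ hθ (toCLM a) g'⟫_ℂ)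
      {a : H →WOT[ℂ] H | ‖toCLM a‖ ≤ r} := by
  set B : Set (H →WOT[ℂ] H) := {a : H →WOT[ℂ] H | ‖toCLM a‖ ≤ r} with hB
  let N (g' : KSpace hκ) : Submodule ℂ (KSpace hκ) :=
    { carrier := {g | ContinuousOn (fun a : H →WOT[ℂ] H => ⟪kact hκ hθ (toCLM a) g', g⟫_ℂ) B}
      add_mem' := fun {x y} hx hy => by
        simp only [Set.mem_ofPred_eq, inner_add_right] at hx hy ⊢
        exact hx.add hy
      zero_mem' := by simpa using continuousOn_const
      smul_mem' := fun c x hx => by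
        simp only [Set.mem_ofPred_eq, inner_smul_right] at hx ⊢
        exact continuousOn_const.mul hx }
  have hN : ∀ g', IsClosed (N g' : Set (KSpace hκ)) := fun g' => by
    refine isClosed_of_closure_subset fun x hx => ?_
    refine continuousOn_of_uniform_approx_of_continuousOn fun u hu => ?_
    obtain ⟨ε, hε, hu⟩ := Metric.mem_uniformity_dist.mp hu
    have hpos : 0 < |r| * ‖g'‖ + 1 := by positivity
    obtain ⟨y, hy, hxy⟩ := Metric.mem_closure_iff.mp hx (ε / (|r| * ‖g'‖ + 1)) (by positivity)
    refine ⟨_, hy, fun a ha => hu ?_⟩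
    rw [dist_eq_norm, ← inner_sub_right]
    rw [dist_eq_norm, lt_div_iff₀ hpos] at hxy
    have h1 : ‖kact hκ hθ (toCLM a) g'‖ ≤ |r| * ‖g'‖ :=
      (kact_norm_le hκ hθ _ _).trans (by gcongr; exact ha.trans (le_abs_self r))
    calc _ ≤ ‖kact hκ hθ (toCLM a) g'‖ * ‖x - y‖ := norm_inner_le_norm _ _
      _ ≤ (|r| * ‖g'‖ + 1) * ‖x - y‖ := by gcongr; linarith
      _ < ε := by rwa [mul_comm]
  have conj : ∀ x y : KSpace hκ,
      ContinuousOn (fun a : H →WOT[ℂ] H => ⟪kact hκ hθ (toCLM a) x, y⟫_ℂ) B →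
      ContinuousOn (fun a : H →WOT[ℂ] H => ⟪y, kact hκ hθ (toCLM a) x⟫_ℂ) B := fun x y h => by
    have := Complex.continuous_conj.comp_continuousOn h
    refine this.congr fun a _ => ?_
    simp
  have key : ∀ s h g, ContinuousOn
      (fun a : H →WOT[ℂ] H => ⟪kact hκ hθ (toCLM a) (kvec hκ s h), g⟫_ℂ) B := fun s h g => by
    refine kspace_span hκ (N (kvec hκ s h)) (hN _) (fun t k => ?_) g
    have h1 := (ContinuousLinearMapWOT.continuousOn_iff.mp ((hθ.normal t s).2 r)) h k
    have h2 := Complex.continuous_conj.comp_continuousOn h1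
    refine h2.congr fun a _ => ?_
    simp [kact_kvec, ← inner_kvec hκ]
  have hstar : Set.MapsTo (star : (H →WOT[ℂ] H) → (H →WOT[ℂ] H)) B B := fun a ha => by
    have h2 : toCLM (star a) = star (toCLM a) := rfl
    simp only [hB, Set.mem_ofPred_eq] at ha ⊢
    rwa [h2, norm_star]
  refine conj _ _ (kspace_span hκ (N g') (hN g') (fun s h => ?_) g)
  have h1 := (key s h g').comp (continuous_star.continuousOn) hstar
  have h2 := Complex.continuous_conj.comp_continuousOn h1
  refine h2.congr fun a _ => ?_
  have h3 : toCLM (star a) = star (toCLM a) := rfl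
  simp [kact_adj, h3]

end Kolmogorov

/-! ### W*-correspondences over `B(H)` -/

variable (H) in
/-- A `W*`-correspondence over `B(H)`: a self-dual right Hilbert `C*`-module `F` over `B(H)`, with
inner product `ip` (linear in the second variable), together with a unital normal *-homomorphism
`lact` of `B(H)` into its adjointable operators.  (The remaining module laws, the linearity of
`lact b` and of `b ↦ lact b`, and completeness are consequences of the listed ones.) -/
structure WStarCorr where
  carrier : Type u
  [grp : AddCommGroup carrier]
  [mod : Module ℂ carrier]
  /-- right multiplication `x · c` -/
  rsmul : carrier → (H →L[ℂ] H) → carrier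
  /-- left action `φ(b) x` -/
  lact : (H →L[ℂ] H) → carrier → carrier
  /-- `B(H)`-valued inner product -/
  ip : carrier → carrier → (H →L[ℂ] H)
  ip_add_right : ∀ x y z, ip x (y + z) = ip x y + ip x z
  ip_smul_right : ∀ (c : ℂ) x y, ip x (c • y) = c • ip x y
  ip_rsmul_right : ∀ x y c, ip x (rsmul y c) = ip x y * c
  star_ip : ∀ x y, star (ip x y) = ip y x
  ip_self_nonneg : ∀ x, 0 ≤ ip x x
  ip_self_eq_zero : ∀ x, ip x x = 0 → x = 0
  selfDual : ∀ f : carrier →ₗ[ℂ] (H →L[ℂ] H), (∀ x c, f (rsmul x c) = f x * c) →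
    (∃ C : ℝ, ∀ x, ‖f x‖ ≤ C * √‖ip x x‖) → ∃ y, ∀ x, f x = ip y x
  lact_one : ∀ x, lact 1 x = x
  lact_mul : ∀ a b x, lact (a * b) x = lact a (lact b x)
  lact_adj : ∀ b x y, ip (lact b x) y = ip x (lact (star b) y)
  lact_normal : ∀ x y, IsNormalMap fun b => ip x (lact b y)

namespace WStarCorr

instance (F : WStarCorr H) : AddCommGroup F.carrier := F.grp
instance (F : WStarCorr H) : Module ℂ F.carrier := F.mod

variable (F : WStarCorr H)

/-- `ip x` as a linear map. -/
def ipLin (x : F.carrier) : F.carrier →ₗ[ℂ] (H →L[ℂ] H) where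
  toFun := F.ip x
  map_add' := F.ip_add_right x
  map_smul' c y := F.ip_smul_right c x y

lemma ip_sum_right {ι : Type*} (s : Finset ι) (x : F.carrier) (y : ι → F.carrier) :
    F.ip x (∑ i ∈ s, y i) = ∑ i ∈ s, F.ip x (y i) := map_sum (F.ipLin x) y s

lemma ip_sum_left {ι : Type*} (s : Finset ι) (x : ι → F.carrier) (y : F.carrier) :
    F.ip (∑ i ∈ s, x i) y = ∑ i ∈ s, F.ip (x i) y := by
  rw [← F.star_ip, ip_sum_right, star_sum]
  simp_rw [F.star_ip]

lemma ip_rsmul_left (x y : F.carrier) (c : H →L[ℂ] H) :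
    F.ip (F.rsmul x c) y = star c * F.ip x y := by
  rw [← F.star_ip, F.ip_rsmul_right, star_mul, F.star_ip]

variable [Nontrivial H]

lemma posDef : PosDefKernel F.ip := by
  intro n x h
  obtain ⟨e, he⟩ := exists_norm_eq H zero_le_one
  have hee : ⟪e, e⟫_ℂ = 1 := by simp [inner_self_eq_norm_sq_to_K, he]
  set y := ∑ i, F.rsmul (x i) (InnerProductSpace.rankOne ℂ (h i) e) with hy
  have h1 := ((ContinuousLinearMap.nonneg_iff_isPositive _).mp (F.ip_self_nonneg y)).inner_nonneg_right e
  convert h1 using 1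
  rw [hy, F.ip_sum_left]
  simp_rw [F.ip_sum_right]
  simp only [F.ip_rsmul_left, F.ip_rsmul_right, _root_.sum_apply, inner_sum,
    mul_apply_eq_comp, ContinuousLinearMap.star_eq_adjoint, ContinuousLinearMap.adjoint_inner_right,
    InnerProductSpace.rankOne_apply, hee, one_smul]

lemma kAction : KAction F.ip F.lact :=
  ⟨F.lact_one, F.lact_mul, F.lact_adj, F.lact_normal⟩

/-- The Hilbert space `F ⊗_σ H`, for `σ` the identity representation of `B(H)` on `H`: the
separated completion of the span of elementary tensors `x ⊗ h` (`x ∈ F`, `h ∈ H`) in the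
semi-inner product with `⟪x ⊗ h, y ⊗ k⟫ = ⟪h, ⟨x, y⟩ k⟫`.  The bilinearity and balancing relations
of the tensor product are among the null vectors of this semi-inner product, see `tmul_add`,
`tmul_smul` and `tmul_rsmul`. -/
abbrev Tensor : Type u := KSpace F.posDef

/-- The operator `h ↦ x ⊗ h`. -/
def tmul (x : F.carrier) : H →L[ℂ] F.Tensor := kvec F.posDef x

lemma inner_tmul (x y : F.carrier) (h k : H) : ⟪F.tmul x h, F.tmul y k⟫_ℂ = ⟪h, F.ip x y k⟫_ℂ :=
  inner_kvec F.posDef x y h k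

lemma tmul_add (x y : F.carrier) (h : H) : F.tmul (x + y) h = F.tmul x h + F.tmul y h := by
  refine kspace_ext F.posDef _ _ fun z k => ?_
  rw [inner_add_right]
  simp only [tmul, inner_kvec, F.ip_add_right, _root_.add_apply, inner_add_right]

lemma tmul_smul (c : ℂ) (x : F.carrier) (h : H) : F.tmul (c • x) h = c • F.tmul x h := by
  refine kspace_ext F.posDef _ _ fun z k => ?_
  rw [inner_smul_right]
  simp only [tmul, inner_kvec, F.ip_smul_right, _root_.smul_apply, inner_smul_right]

lemma tmul_rsmul (x : F.carrier) (c : H →L[ℂ] H) (h : H) :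
    F.tmul (F.rsmul x c) h = F.tmul x (c h) := by
  refine kspace_ext F.posDef _ _ fun z k => ?_
  simp only [tmul, inner_kvec, F.ip_rsmul_right, mul_apply_eq_comp]

/-- The bounded operator `φ(b) ⊗ I_H` on `F ⊗_σ H`. -/
def lactTensor (b : H →L[ℂ] H) : F.Tensor →L[ℂ] F.Tensor := kact F.posDef F.kAction b

lemma lactTensor_tmul (b : H →L[ℂ] H) (x : F.carrier) (h : H) :
    F.lactTensor b (F.tmul x h) = F.tmul (F.lact b x) h :=
  kact_kvec F.posDef F.kAction b x h

/-- The `σ`-dual `F^σ` for `σ` the identity representation of `B(H)` on `H`: all bounded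
`Y : H → F ⊗_σ H` with `Y σ(b) = (φ(b) ⊗ I_H) Y` for all `b ∈ B(H)`. -/
def sigmaDual : Submodule ℂ (H →L[ℂ] F.Tensor) where
  carrier := {Y | ∀ b : H →L[ℂ] H, Y ∘L b = F.lactTensor b ∘L Y}
  add_mem' := fun {Y Z} hY hZ b => by
    rw [ContinuousLinearMap.add_comp, ContinuousLinearMap.comp_add, hY b, hZ b]
  zero_mem' := fun b => by simp
  smul_mem' := fun c Y hY b => by
    rw [ContinuousLinearMap.smul_comp, ContinuousLinearMap.comp_smul, hY b]

/-- The inner product `⟨Y, Z⟩ = Y* Z` of the `σ`-dual, with values in the commutant of `B(H)`. -/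
def sigmaDualInner (Y Z : F.sigmaDual) : H →L[ℂ] H :=
  ContinuousLinearMap.adjoint (Y : H →L[ℂ] F.Tensor) ∘L (Z : H →L[ℂ] F.Tensor)

end WStarCorr

/-! ### The reproducing kernel correspondence of a completely positive map-valued kernel -/

section RKCorr

variable {Z : Type u} {K : Z → Z → (H →L[ℂ] H) → (H →L[ℂ] H)}

/-- Completely positive kernels on `Z` with values in the normal bounded linear maps on `B(H)`:
for `z₁, …, zₙ` in `Z` the map `(a_{ij}) ↦ (K(z_i,z_j)(a_{ij}))` on `M_n(B(H))` is `m`-positive for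
every `m` (elements of `M_m(M_n(B(H)))` are indexed by `Fin m × Fin n`). -/
structure IsCPKernel (K : Z → Z → (H →L[ℂ] H) → (H →L[ℂ] H)) : Prop where
  normal : ∀ z w, IsNormalMap (K z w)
  cp : ∀ (n m : ℕ) (z : Fin n → Z) (A : Fin m × Fin n → Fin m × Fin n → (H →L[ℂ] H)),
    BlockPos A → BlockPos fun p q => K (z p.2) (z q.2) (A p q)

/-- The Gram kernel `⟨k_{(b,z)}, k_{(a,w)}⟩ = K(z,w)(b a*)` of the kernel functions. -/
def rkGram (K : Z → Z → (H →L[ℂ] H) → (H →L[ℂ] H)) (p q : (H →L[ℂ] H) × Z) : H →L[ℂ] H :=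
  K p.2 q.2 (p.1 * star q.1)

/-- The left action of `b` on indices of kernel functions: `b · k_{(a,w)} = k_{(a b*, w)}`. -/
def rkShift (b : H →L[ℂ] H) (p : (H →L[ℂ] H) × Z) : (H →L[ℂ] H) × Z := (p.1 * star b, p.2)

lemma rkGram_posDef (hK : IsCPKernel K) : PosDefKernel (rkGram K) := by
  intro n s x
  have hA : BlockPos fun p q : Fin 1 × Fin n => (s p.2).1 * star (s q.2).1 := by
    intro y
    have : ∑ i, ∑ j, ⟪y i, ((s i.2).1 * star (s j.2).1) (y j)⟫_ℂ
        = ⟪∑ i, star (s i.2).1 (y i), ∑ j, star (s j.2).1 (y j)⟫_ℂ := by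
      rw [sum_inner]
      simp_rw [inner_sum, mul_apply_eq_comp, ContinuousLinearMap.star_eq_adjoint,
        ContinuousLinearMap.adjoint_inner_left]
    rw [this]
    exact Complex.nonneg_iff.mpr ⟨inner_self_nonneg (𝕜 := ℂ), (inner_self_im (𝕜 := ℂ) _).symm⟩
  have h := hK.cp n 1 (fun i => (s i).2) _ hA (fun p => x p.2)
  simpa [Fintype.sum_prod_type, rkGram] using h

lemma IsNormalMap.comp_mul {φ : (H →L[ℂ] H) → (H →L[ℂ] H)} (hφ : IsNormalMap φ)
    (a c : H →L[ℂ] H) : IsNormalMap fun b => φ (a * (b * c)) := by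
  refine ⟨hφ.1.comp (g := φ) (f := fun b => a * (b * c)) ?_, fun r => ?_⟩
  · exact (ContinuousLinearMap.isBoundedLinearMap
      ((ContinuousLinearMap.mul ℂ (H →L[ℂ] H) a) ∘L
        ((ContinuousLinearMap.mul ℂ (H →L[ℂ] H)).flip c)))
  · have h1 := hφ.2 (‖a‖ * (|r| * ‖c‖))
    have h2 : Continuous fun b : H →WOT[ℂ] H => ofCLM (a * (toCLM b * c)) :=
      (ContinuousLinearMapWOT.continuous_postcomp (ofCLM a)).comp
        (ContinuousLinearMapWOT.continuous_precomp (ofCLM c))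
    refine h1.comp h2.continuousOn fun b hb => ?_
    simp only [Set.mem_ofPred_eq] at hb ⊢
    calc ‖a * (toCLM b * c)‖ ≤ ‖a‖ * (‖toCLM b‖ * ‖c‖) :=
          (norm_mul_le _ _).trans (by gcongr; exact norm_mul_le _ _)
      _ ≤ _ := by gcongr; exact hb.trans (le_abs_self r)

lemma rkShift_action (hK : IsCPKernel K) : KAction (rkGram K) (rkShift (Z := Z)) where
  one p := by simp [rkShift]
  mul a b p := by simp [rkShift, mul_assoc]
  adj b p q := by simp [rkShift, rkGram, mul_assoc]
  normal p q := by
    have := (hK.normal p.2 q.2).comp_mul p.1 (star q.1)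
    simpa [rkShift, rkGram] using this

/-- The Hilbert space generated by the vectors `k_{(a,w)} ⊗ h`. -/
abbrev RKSpace (hK : IsCPKernel K) : Type u := KSpace (rkGram_posDef hK)

/-- The kernel function `k_{(a,w)}`, as the operator `h ↦ k_{(a,w)} ⊗ h`. -/
def rkVec (hK : IsCPKernel K) (a : H →L[ℂ] H) (w : Z) : H →L[ℂ] RKSpace hK :=
  kvec (rkGram_posDef hK) (a, w)

/-- The right `B(H)`-module generated by the kernel functions is `span {k_{(a,w)} c}`, with
`⟨x, y⟩ = x* y`; the `W*`-module it generates is its closure in the weak operator topology. -/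
def rkModule (hK : IsCPKernel K) : Submodule ℂ (H →WOT[ℂ] RKSpace hK) :=
  (Submodule.span ℂ {x | ∃ (a : H →L[ℂ] H) (w : Z) (c : H →L[ℂ] H),
    x = ofCLM (rkVec hK a w ∘L c)}).topologicalClosure

lemma rankOne_mem_rkModule (hK : IsCPKernel K) (g : RKSpace hK) (h : H) :
    ofCLM (InnerProductSpace.rankOne ℂ g h) ∈ rkModule hK := by
  let ρ : RKSpace hK →L[ℂ] (H →WOT[ℂ] RKSpace hK) :=
    ContinuousLinearMap.WOTofCLM (𝕜₂ := ℂ) (σ := RingHom.id ℂ) (E := H) (F := RKSpace hK) ∘L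
      ContinuousLinearMap.smulRightL ℂ H (RKSpace hK) (innerSL ℂ h)
  let N : Submodule ℂ (RKSpace hK) := (rkModule hK).comap ρ.toLinearMap
  have hN : IsClosed (N : Set (RKSpace hK)) :=
    (Submodule.isClosed_topologicalClosure _).preimage ρ.continuous
  refine kspace_span (rkGram_posDef hK) N hN (fun s x => ?_) g
  refine Submodule.le_topologicalClosure _ (Submodule.subset_span ?_)
  refine ⟨s.1, s.2, InnerProductSpace.rankOne ℂ x h, ?_⟩
  rw [InnerProductSpace.comp_rankOne]
  rfl

lemma mem_rkModule (hK : IsCPKernel K) (x : H →WOT[ℂ] RKSpace hK) : x ∈ rkModule hK := by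
  obtain ⟨w, b, -⟩ := exists_hilbertBasis ℂ H
  have h : HasSum (fun i => ofCLM (InnerProductSpace.rankOne ℂ (x (b i)) (b i))) x := by
    refine ContinuousLinearMapWOT.tendsto_iff_forall_inner_apply_tendsto.mpr fun k g => ?_
    have h1 := b.hasSum_inner_mul_inner (ContinuousLinearMap.adjoint (toCLM x) g) k
    simp only [ContinuousLinearMap.adjoint_inner_left] at h1
    refine h1.congr fun s => ?_
    have h2 : (∑ i ∈ s, ofCLM (InnerProductSpace.rankOne ℂ (x (b i)) (b i)) :
        H →WOT[ℂ] RKSpace hK) = ofCLM (∑ i ∈ s, InnerProductSpace.rankOne ℂ (x (b i)) (b i)) :=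
      (map_sum (ContinuousLinearMap.WOTofCLM (𝕜₂ := ℂ) (σ := RingHom.id ℂ) (E := H) (F := RKSpace hK)) _ s).symm
    rw [h2, ContinuousLinearMapWOT.ofCLM_apply, _root_.sum_apply, inner_sum]
    refine Finset.sum_congr rfl fun i _ => ?_
    rw [InnerProductSpace.rankOne_apply, inner_smul_right, mul_comm]
    rfl
  exact (Submodule.isClosed_topologicalClosure _).mem_of_tendsto h
    (Filter.Eventually.of_forall fun s => Submodule.sum_mem _ fun i _ =>
      rankOne_mem_rkModule hK _ _)

/-- An operator `H → RKSpace` as an element of the module. -/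
def rkMk (hK : IsCPKernel K) : (H →L[ℂ] RKSpace hK) →ₗ[ℂ] rkModule hK where
  toFun x := ⟨ofCLM x, mem_rkModule hK _⟩
  map_add' _ _ := rfl
  map_smul' _ _ := rfl

/-- The operator `H → RKSpace` of an element of the module. -/
def rkOp (hK : IsCPKernel K) : rkModule hK →ₗ[ℂ] (H →L[ℂ] RKSpace hK) where
  toFun x := toCLM x.1
  map_add' _ _ := rfl
  map_smul' _ _ := rfl

lemma rkOp_rkMk (hK : IsCPKernel K) (x : H →L[ℂ] RKSpace hK) : rkOp hK (rkMk hK x) = x := rfl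

lemma rkOp_injective (hK : IsCPKernel K) : Function.Injective (rkOp hK) := fun _ _ h =>
  Subtype.ext (ContinuousLinearMapWOT.toCLM_injective h)

/-- The representation `b ↦ (k_{(a,w)} ⊗ h ↦ k_{(a b*,w)} ⊗ h)`. -/
def rkRep (hK : IsCPKernel K) (b : H →L[ℂ] H) : RKSpace hK →L[ℂ] RKSpace hK :=
  kact (rkGram_posDef hK) (rkShift_action hK) b

lemma rkRep_one (hK : IsCPKernel K) (x : rkModule hK) :
    rkMk hK (rkRep hK 1 ∘L rkOp hK x) = x := by
  apply rkOp_injective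
  rw [rkOp_rkMk, rkRep, kact_one]
  exact ContinuousLinearMap.id_comp _

lemma rkRep_mul (hK : IsCPKernel K) (a b : H →L[ℂ] H) (x : rkModule hK) :
    rkMk hK (rkRep hK (a * b) ∘L rkOp hK x) =
      rkMk hK (rkRep hK a ∘L rkOp hK (rkMk hK (rkRep hK b ∘L rkOp hK x))) := by
  apply rkOp_injective
  rw [rkOp_rkMk, rkOp_rkMk, rkOp_rkMk, rkRep, kact_mul]
  exact ContinuousLinearMap.comp_assoc _ _ _

lemma rkRep_adj (hK : IsCPKernel K) (b : H →L[ℂ] H) (x y : rkModule hK) :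
    ContinuousLinearMap.adjoint (rkOp hK (rkMk hK (rkRep hK b ∘L rkOp hK x))) ∘L rkOp hK y =
      ContinuousLinearMap.adjoint (rkOp hK x) ∘L
        rkOp hK (rkMk hK (rkRep hK (star b) ∘L rkOp hK y)) := by
  refine ContinuousLinearMap.ext fun h => ext_inner_left ℂ fun k => ?_
  rw [rkOp_rkMk, rkOp_rkMk, ContinuousLinearMap.comp_apply, ContinuousLinearMap.comp_apply,
    ContinuousLinearMap.adjoint_inner_right, ContinuousLinearMap.adjoint_inner_right,
    ContinuousLinearMap.comp_apply, ContinuousLinearMap.comp_apply]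
  exact kact_adj _ _ b _ _

lemma rk_self_eq_zero (hK : IsCPKernel K) (x : rkModule hK)
    (hx : ContinuousLinearMap.adjoint (rkOp hK x) ∘L rkOp hK x = 0) : x = 0 := by
  apply rkOp_injective
  rw [map_zero]
  refine ContinuousLinearMap.ext fun h => ?_
  have h1 : ⟪rkOp hK x h, rkOp hK x h⟫_ℂ = 0 := by
    rw [← ContinuousLinearMap.adjoint_inner_right, ← ContinuousLinearMap.comp_apply, hx]
    simp
  exact inner_self_eq_zero.mp h1

lemma rk_selfDual [Nontrivial H] (hK : IsCPKernel K) (f : rkModule hK →ₗ[ℂ] (H →L[ℂ] H))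
    (hf : ∀ x c, f (rkMk hK (rkOp hK x ∘L c)) = f x * c)
    (hC : ∃ C : ℝ, ∀ x, ‖f x‖ ≤ C * √‖ContinuousLinearMap.adjoint (rkOp hK x) ∘L rkOp hK x‖) :
    ∃ y, ∀ x, f x = ContinuousLinearMap.adjoint (rkOp hK y) ∘L rkOp hK x := by
  obtain ⟨C, hC⟩ := hC
  obtain ⟨e, he⟩ := exists_norm_eq H zero_le_one
  have hee : ⟪e, e⟫_ℂ = 1 := by simp [inner_self_eq_norm_sq_to_K, he]
  let ρ : RKSpace hK →ₗ[ℂ] rkModule hK :=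
    rkMk hK ∘ₗ (ContinuousLinearMap.smulRightL ℂ H (RKSpace hK) (innerSL ℂ e)).toLinearMap
  have hρ : ∀ g, rkOp hK (ρ g) = InnerProductSpace.rankOne ℂ g e := fun g => rfl
  let T : RKSpace hK →L[ℂ] H := LinearMap.mkContinuous
    { toFun := fun g => f (ρ g) e
      map_add' := fun g g' => by simp
      map_smul' := fun c g => by simp } C fun g => by
        refine ((f (ρ g)).le_opNorm e).trans ?_
        rw [he, mul_one]
        refine (hC (ρ g)).trans_eq ?_
        rw [ContinuousLinearMap.norm_adjoint_comp_self, hρ, InnerProductSpace.norm_rankOne, he,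
          mul_one, Real.sqrt_mul_self (norm_nonneg _)]
  refine ⟨rkMk hK (ContinuousLinearMap.adjoint T), fun x => ?_⟩
  rw [rkOp_rkMk, ContinuousLinearMap.adjoint_adjoint]
  refine ContinuousLinearMap.ext fun h => ?_
  have h1 := hf x (InnerProductSpace.rankOne ℂ h e)
  rw [InnerProductSpace.comp_rankOne] at h1
  have h2 : T (rkOp hK x h) = f (rkMk hK (InnerProductSpace.rankOne ℂ (rkOp hK x h) e)) e := rfl
  rw [ContinuousLinearMap.comp_apply, h2, h1, mul_apply_eq_comp, InnerProductSpace.rankOne_apply,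
    hee, one_smul]

lemma rk_normal (hK : IsCPKernel K) (x y : H →L[ℂ] RKSpace hK) :
    IsNormalMap fun b => ContinuousLinearMap.adjoint x ∘L (rkRep hK b ∘L y) := by
  refine ⟨⟨⟨fun a b => ?_, fun c a => ?_⟩, ?_⟩, fun r => ?_⟩
  · rw [rkRep, kact_add, ContinuousLinearMap.add_comp, ContinuousLinearMap.comp_add]; rfl
  · rw [rkRep, kact_smul, ContinuousLinearMap.smul_comp, ContinuousLinearMap.comp_smul]; rfl
  · refine ⟨‖x‖ * ‖y‖ + 1, by positivity, fun b => ?_⟩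
    have hb : ‖rkRep hK b‖ ≤ ‖b‖ :=
      ContinuousLinearMap.opNorm_le_bound _ (norm_nonneg _) (kact_norm_le _ _ b)
    have h1 := ContinuousLinearMap.opNorm_comp_le (ContinuousLinearMap.adjoint x) (rkRep hK b ∘L y)
    have h2 := ContinuousLinearMap.opNorm_comp_le (rkRep hK b) y
    rw [LinearIsometryEquiv.norm_map] at h1
    calc _ ≤ ‖x‖ * (‖b‖ * ‖y‖) := h1.trans (by gcongr; exact h2.trans (by gcongr))
      _ ≤ _ := by nlinarith [norm_nonneg b]
  · refine ContinuousLinearMapWOT.continuousOn_iff.mpr fun h k => ?_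
    have := kact_normal (rkGram_posDef hK) (rkShift_action hK) r (x k) (y h)
    refine this.congr fun a _ => ?_
    rw [ContinuousLinearMapWOT.ofCLM_apply, ContinuousLinearMap.comp_apply,
      ContinuousLinearMap.adjoint_inner_right]
    rfl

variable [Nontrivial H]

/-- The reproducing kernel correspondence `E_K` over `B(H)`: the `W*`-module generated by the
kernel functions, with `⟨x, y⟩ = x* y` and `b · k_{(a,w)} = k_{(a b*,w)}`. -/
def rkCorr (hK : IsCPKernel K) : WStarCorr H where
  carrier := rkModule hK
  rsmul x c := rkMk hK (rkOp hK x ∘L c)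
  lact b x := rkMk hK (rkRep hK b ∘L rkOp hK x)
  ip x y := ContinuousLinearMap.adjoint (rkOp hK x) ∘L rkOp hK y
  ip_add_right x y z := by rw [map_add, ContinuousLinearMap.comp_add]
  ip_smul_right c x y := by rw [map_smul, ContinuousLinearMap.comp_smul]
  ip_rsmul_right x y c := rfl
  star_ip x y := by
    rw [ContinuousLinearMap.star_eq_adjoint, ContinuousLinearMap.adjoint_comp,
      ContinuousLinearMap.adjoint_adjoint]
  ip_self_nonneg x := by
    rw [ContinuousLinearMap.nonneg_iff_isPositive]
    exact ContinuousLinearMap.isPositive_adjoint_comp_self _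
  ip_self_eq_zero := rk_self_eq_zero hK
  selfDual := rk_selfDual hK
  lact_one := rkRep_one hK
  lact_mul := rkRep_mul hK
  lact_adj := rkRep_adj hK
  lact_normal x y := rk_normal hK (rkOp hK x) (rkOp hK y)

/-- The kernel function `k_{(a,w)}` as an element of `E_K`. -/
def rkKernel (hK : IsCPKernel K) (a : H →L[ℂ] H) (w : Z) : (rkCorr hK).carrier :=
  rkMk hK (rkVec hK a w)

lemma ip_rkKernel (hK : IsCPKernel K) (a b : H →L[ℂ] H) (z w : Z) :
    (rkCorr hK).ip (rkKernel hK b z) (rkKernel hK a w) = K z w (b * star a) := by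
  refine ContinuousLinearMap.ext fun h => ext_inner_left ℂ fun k => ?_
  exact (ContinuousLinearMap.adjoint_inner_right (rkVec hK b z) k (rkVec hK a w h)).trans
    (inner_kvec (rkGram_posDef hK) (b, z) (a, w) k h)

lemma lact_rkKernel (hK : IsCPKernel K) (b a : H →L[ℂ] H) (w : Z) :
    (rkCorr hK).lact b (rkKernel hK a w) = rkKernel hK (a * star b) w :=
  congrArg (rkMk hK) (ContinuousLinearMap.ext fun h =>
    kact_kvec (rkGram_posDef hK) (rkShift_action hK) b (a, w) h)

/-- Elements of `E_K` as functions on `Z` with values in the maps on `B(H)`: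
`f(z)(a) = ⟨k_{(a,z)}, f⟩`. -/
def rkEval (hK : IsCPKernel K) (f : (rkCorr hK).carrier) (z : Z) (a : H →L[ℂ] H) : H →L[ℂ] H :=
  (rkCorr hK).ip (rkKernel hK a z) f

lemma rkEval_injective (hK : IsCPKernel K) : Function.Injective (rkEval hK) := by
  intro f g hfg
  refine rkOp_injective hK (ContinuousLinearMap.ext fun h => ?_)
  refine kspace_ext (rkGram_posDef hK) _ _ fun s x => ?_
  have h1 : rkEval hK f s.2 s.1 h = rkEval hK g s.2 s.1 h := by rw [hfg]
  have h2 : ∀ f : (rkCorr hK).carrier,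
      ⟪x, rkEval hK f s.2 s.1 h⟫_ℂ = ⟪kvec (rkGram_posDef hK) s x, rkOp hK f h⟫_ℂ := fun f =>
    ContinuousLinearMap.adjoint_inner_right (rkVec hK s.1 s.2) x (rkOp hK f h)
  rw [← h2, ← h2, h1]

end RKCorr

/-! ### Admissible weights, the commutative domain, the kernel and the weighted Fock space -/

section Weights

variable {d : ℕ}

/-- Words of length `k` in `d` letters; they index the standard basis of `(ℂ^d)^{⊗k}`. -/
abbrev Word (d k : ℕ) : Type := Fin k → Fin d

/-- `(ℂ^d)^{⊗k}`, in coordinates with respect to the basis `e_α = e_{α(1)} ⊗ ⋯ ⊗ e_{α(k)}`. -/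
abbrev TensorPow (d k : ℕ) : Type := EuclideanSpace ℂ (Word d k)

/-- Operators on `(ℂ^d)^{⊗k}` as matrices indexed by words. -/
abbrev WordMatrix (d k : ℕ) : Type := Matrix (Word d k) (Word d k) ℂ

/-- The operator on `(ℂ^d)^{⊗k}` of a matrix. -/
def wordOp {k : ℕ} (M : WordMatrix d k) : TensorPow d k →L[ℂ] TensorPow d k :=
  Matrix.toEuclideanCLM (n := Word d k) (𝕜 := ℂ) M

/-- Admissible sequences `(X_k)_{k ≥ 1}` (the entry `X 0` is not used). -/
structure Admissible (X : ∀ k : ℕ, WordMatrix d k) : Prop where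
  isUnit_one : IsUnit (X 1)
  posSemidef : ∀ k, 1 ≤ k → (X k).PosSemidef
  limsup_lt : Filter.limsup (fun k : ℕ => ENNReal.ofReal (‖wordOp (X k)‖ ^ (1 / (k : ℝ))))
    Filter.atTop < ⊤

/-- `R_k² = ∑_{l} ∑_{k₁ + ⋯ + k_l = k, k_i ≥ 1} X_{k₁} ⊗ ⋯ ⊗ X_{k_l}`, as a matrix indexed by words;
`c.embedding i` is the inclusion of the positions of the `i`-th block.  For `k = 0` there is only
the empty composition and `R_0² = 1`. -/
def Rsq (X : ∀ k : ℕ, WordMatrix d k) (k : ℕ) : WordMatrix d k :=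
  Matrix.of fun α β => ∑ c : Composition k, ∏ i : Fin c.length,
    X (c.blocksFun i) (α ∘ c.embedding i) (β ∘ c.embedding i)

/-- `R_k`, the positive square root of `R_k²`. -/
def Rop (X : ∀ k : ℕ, WordMatrix d k) (k : ℕ) : TensorPow d k →L[ℂ] TensorPow d k :=
  CFC.sqrt (wordOp (Rsq X k))

/-- The symmetric tensors `(ℂ^d)^{Ⓢk}`. -/
def symPow (d k : ℕ) : Submodule ℂ (TensorPow d k) where
  carrier := {v | ∀ (π : Equiv.Perm (Fin k)) (α : Word d k), v (α ∘ π) = v α}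
  add_mem' := fun {v w} hv hw π α => by simp [hv π α, hw π α]
  zero_mem' := fun π α => by simp
  smul_mem' := fun c v hv π α => by simp [hv π α]

/-- The full Fock space `⊕_k (ℂ^d)^{⊗k}` (Hilbert space direct sum). -/
abbrev FullFock (d : ℕ) : Type := lp (fun k : ℕ => TensorPow d k) 2

/-- `F(R) = ⊕_k R_k (ℂ^d)^{Ⓢk}`, a closed subspace of the full Fock space. -/
def weightedFock (X : ∀ k : ℕ, WordMatrix d k) : Submodule ℂ (FullFock d) where
  carrier := {f | ∀ k, f k ∈ (symPow d k).map (Rop X k).toLinearMap}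
  add_mem' := fun {f g} hf hg k => by
    rw [lp.coeFn_add]; exact Submodule.add_mem _ (hf k) (hg k)
  zero_mem' := fun k => by rw [lp.coeFn_zero]; exact Submodule.zero_mem _
  smul_mem' := fun c f hf k => by
    rw [lp.coeFn_smul]; exact Submodule.smul_mem _ c (hf k)

/-- `T_α = T_{α(1)} ⋯ T_{α(k)}`. -/
def wordProd {k : ℕ} (T : Fin d → (H →L[ℂ] H)) (α : Word d k) : H →L[ℂ] H :=
  (List.ofFn fun i => T (α i)).prod

/-- `V^{(k)} (M ⊗ a) W^{(k)*} = ∑_{|α| = |β| = k} V_α m_{α,β} a W_β*`. -/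
def homTerm {k : ℕ} (M : WordMatrix d k) (V W : Fin d → (H →L[ℂ] H)) (a : H →L[ℂ] H) :
    H →L[ℂ] H :=
  ∑ α : Word d k, ∑ β : Word d k, M α β • (wordProd V α * a * star (wordProd W β))

/-- `D_c(X, H)`: commuting `d`-tuples `T` in `B(H)` for which
`Φ_T(I) = ∑_{k ≥ 1} T^{(k)} (X_k ⊗ I) T^{(k)*}` converges weak-* with `‖Φ_T(I)‖ < 1`.  (The
terms are positive, so weak-* convergence of the series is convergence in the weak operator
topology.) -/
def commDomain (X : ∀ k : ℕ, WordMatrix d k) (H : Type u) [NormedAddCommGroup H]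
    [InnerProductSpace ℂ H] [CompleteSpace H] : Set (Fin d → (H →L[ℂ] H)) :=
  {T | (∀ i j, T i * T j = T j * T i) ∧ ∃ P : H →L[ℂ] H,
    HasSum (fun k : ℕ => (ofCLM (homTerm (X (k + 1)) T T 1) : H →WOT[ℂ] H)) (ofCLM P) ∧ ‖P‖ < 1}

/-- The terms `V^{(k)} (R_k² ⊗ a) W^{(k)*}` of the kernel series. -/
def kernelTerm (X : ∀ k : ℕ, WordMatrix d k) (V W : commDomain X H) (a : H →L[ℂ] H) (k : ℕ) :
    H →WOT[ℂ] H :=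
  ofCLM (homTerm (Rsq X k) V.1 W.1 a)

/-- The kernel `K^R_c(V, W)(a) = ∑_{k ≥ 0} V^{(k)} (R_k² ⊗ a) W^{(k)*}` on `D_c(X, H)`, the series
being taken in the weak operator topology. -/
def kernelRc (X : ∀ k : ℕ, WordMatrix d k) (H : Type u) [NormedAddCommGroup H]
    [InnerProductSpace ℂ H] [CompleteSpace H] (V W : commDomain X H) (a : H →L[ℂ] H) :
    H →L[ℂ] H :=
  toCLM (∑' k, kernelTerm X V W a k)

end Weights

end RKC

end

noncomputable section

universe u v

namespace RKC

/-! The kernel factors. For `V` in the domain let `L_V h = ((R_k ⊗ I) V^{(k)*} h)_k`, a vector of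
`ℓ²(words) ⊗ H`; then `K(V, W)(a) = L_V* (1 ⊗ a) L_W`. Complete positivity and normality follow from
the factorization (`isCPKernel_of_factored`).

The operator `L_V` is bounded because grouping compositions by their number of parts turns `∑_k
T^{(k)} (R_k² ⊗ I) T^{(k)*}` into `∑_l Φ_T^l(I)`, which is dominated by the geometric series of
`‖Φ_T(I)‖ < 1` (`sum_homTerm_Rsq_le`, `exists_rowOp_bound`).

The vectors `k_{(a,w)} ⊗ h ↦ (1 ⊗ a*) L_w h` embed `E_K ⊗ H` isometrically in `ℓ²(words) ⊗ H`, and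
the left action of `b` becomes `1 ⊗ b` (`corrIso`, `corrIso_lactTensor`). An element of the `σ`-dual
is then an operator intertwining `b` with `1 ⊗ b`, so it has the form `h ↦ ξ ⊗ h`
(`corrIso_sigmaDual`). It remains to find the admissible `ξ`.

Each slice `⟨e, L_V h⟩` is `⊕_k R_k s_k` with `s_k(α) = ⟨e, V_α* h⟩`, symmetric because `V`
commutes; hence `ξ ∈ F(R)` (`slice_mem_flatFock`). Conversely a small scalar tuple `z` lies in the
domain and gives `L_z h = (⊕_k R_k z̄^{⊗k}) ⊗ h`, so these coefficient sequences occur. They span a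
dense subspace of `F(R)`: orthogonality of `f` to all of them is the vanishing of a power series,
hence of each homogeneous polynomial with coefficients `R_k f_k`, and this forces `f = 0`
(`eq_zero_of_orthogonal`). -/

/-! ### Coordinatewise operators on Hilbert sums -/

section HilbertSum

variable {ι : Type v} {E F G : Type*} [NormedAddCommGroup E] [InnerProductSpace ℂ E]
  [NormedAddCommGroup F] [InnerProductSpace ℂ F] [NormedAddCommGroup G] [InnerProductSpace ℂ G]

/-- The Hilbert sum of copies of `E` indexed by `ι`, i.e. `ℓ²(ι) ⊗ E`. -/
abbrev HilbSum (ι : Type v) (E : Type*) [NormedAddCommGroup E] : Type _ := lp (fun _ : ι => E) 2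

lemma memlp_two_iff {E : ι → Type*} [∀ i, NormedAddCommGroup (E i)] {f : ∀ i, E i} :
    Memℓp f 2 ↔ Summable fun i => ‖f i‖ ^ 2 := by
  rw [memℓp_gen_iff (by norm_num)]
  simp

lemma lp_norm_sq {E : ι → Type*} [∀ i, NormedAddCommGroup (E i)] (f : lp E 2) :
    HasSum (fun i => ‖f i‖ ^ 2) (‖f‖ ^ 2) := by
  have := lp.hasSum_norm (p := 2) (by norm_num) f
  simpa using this

/-- `1 ⊗ T` on Hilbert sums: `T` is applied in each coordinate. -/
def lpMap (T : E →L[ℂ] F) : HilbSum ι E →L[ℂ] HilbSum ι F :=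
  LinearMap.mkContinuous
    { toFun := fun f => ⟨fun i => T (f i), memlp_two_iff.mpr
        (.of_nonneg_of_le (fun i => by positivity)
          (fun i => by rw [← mul_pow]; gcongr; exact T.le_opNorm _)
          ((lp_norm_sq f).summable.mul_left (‖T‖ ^ 2)))⟩
      map_add' := fun f g => by ext i; simp; rfl
      map_smul' := fun c f => by ext i; simp } ‖T‖ fun f => by
    refine (sq_le_sq₀ (norm_nonneg _) (by positivity)).mp ?_
    rw [mul_pow]
    refine hasSum_le (fun i => ?_) (lp_norm_sq _) ((lp_norm_sq f).mul_left (‖T‖ ^ 2))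
    rw [← mul_pow]; gcongr; exact T.le_opNorm _

@[simp] lemma lpMap_apply (T : E →L[ℂ] F) (f : HilbSum ι E) (i : ι) : lpMap T f i = T (f i) := rfl

lemma lpMap_norm_le (T : E →L[ℂ] F) : ‖(lpMap T : HilbSum ι E →L[ℂ] HilbSum ι F)‖ ≤ ‖T‖ :=
  LinearMap.mkContinuous_norm_le _ (norm_nonneg _) _

lemma lpMap_comp (S : F →L[ℂ] G) (T : E →L[ℂ] F) (f : HilbSum ι E) :
    lpMap S (lpMap T f) = lpMap (S ∘L T) f := rfl

lemma inner_lpMap_left [CompleteSpace E] [CompleteSpace F] (T : E →L[ℂ] F) (f : HilbSum ι E)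
    (g : HilbSum ι F) :
    ⟪lpMap T f, g⟫_ℂ = ⟪f, lpMap (ContinuousLinearMap.adjoint T) g⟫_ℂ := by
  rw [lp.inner_eq_tsum, lp.inner_eq_tsum]
  refine tsum_congr fun i => ?_
  rw [lpMap_apply, lpMap_apply, ContinuousLinearMap.adjoint_inner_right]

/-- The column operator `h ↦ (A_i h)_i`. -/
def lpCol (A : ι → (E →L[ℂ] F)) (C : ℝ) (hA : ∀ (s : Finset ι) (h : E), ∑ i ∈ s, ‖A i h‖ ^ 2 ≤ C * ‖h‖ ^ 2) :
    E →L[ℂ] HilbSum ι F :=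
  LinearMap.mkContinuous
    { toFun := fun h => ⟨fun i => A i h, memlp_two_iff.mpr
        (summable_of_sum_le (fun i => by positivity) (fun s => hA s h))⟩
      map_add' := fun f g => by ext i; simp; rfl
      -- The hypothesis does not record `0 ≤ C`, hence the absolute value.
      map_smul' := fun c f => by ext i; simp } (√|C|) fun h => by
    refine (sq_le_sq₀ (norm_nonneg _) (by positivity)).mp ?_
    rw [mul_pow, Real.sq_sqrt (abs_nonneg _)]
    refine hasSum_le_of_sum_le (lp_norm_sq _) fun s => (hA s h).trans ?_
    gcongr; exact le_abs_self C

@[simp] lemma lpCol_apply (A : ι → (E →L[ℂ] F)) (C : ℝ)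
    (hA : ∀ (s : Finset ι) (h : E), ∑ i ∈ s, ‖A i h‖ ^ 2 ≤ C * ‖h‖ ^ 2) (h : E) (i : ι) :
    lpCol A C hA h i = A i h := rfl

/-- The elementary tensor `ξ ⊗ h` in `ℓ²(ι) ⊗ E`, as an operator in `h`. -/
def tensorVec : HilbSum ι ℂ →ₗ[ℂ] (E →L[ℂ] HilbSum ι E) where
  toFun ξ := LinearMap.mkContinuous
    { toFun := fun h => lpMap (ContinuousLinearMap.toSpanSingleton ℂ h) ξ
      map_add' := fun f g => by ext i; simp
      map_smul' := fun c f => by ext i; exact smul_comm _ _ _ } ‖ξ‖ fun h => by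
    refine ((lpMap (ContinuousLinearMap.toSpanSingleton ℂ h)).le_opNorm ξ).trans ?_
    rw [mul_comm]
    gcongr
    exact (lpMap_norm_le _).trans (ContinuousLinearMap.norm_toSpanSingleton h).le
  map_add' f g := by ext; simp
  map_smul' c f := by ext; simp

@[simp] lemma tensorVec_apply (ξ : HilbSum ι ℂ) (h : E) (i : ι) :
    tensorVec ξ h i = ξ i • h := rfl

lemma lpMap_tensorVec (T : E →L[ℂ] F) (ξ : HilbSum ι ℂ) (h : E) :
    lpMap T (tensorVec ξ h) = tensorVec ξ (T h) := by
  ext i; simp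

lemma inner_tensorVec (ξ η : HilbSum ι ℂ) (h k : E) :
    ⟪tensorVec ξ h, tensorVec η k⟫_ℂ = ⟪ξ, η⟫_ℂ * ⟪h, k⟫_ℂ := by
  refine (lp.hasSum_inner _ _).unique ?_
  refine ((lp.hasSum_inner ξ η).mul_right ⟪h, k⟫_ℂ).congr_fun ?_
  intro i
  simp [inner_smul_left, inner_smul_right]
  ring

lemma lpMap_rankOne (h e : E) (g : HilbSum ι E) :
    lpMap (InnerProductSpace.rankOne ℂ h e) g = tensorVec (lpMap (innerSL ℂ e) g) h := by
  ext i; simp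

lemma lpMap_innerSL_lpMap [CompleteSpace E] [CompleteSpace F] (e : F) (T : E →L[ℂ] F)
    (g : HilbSum ι E) :
    lpMap (innerSL ℂ e) (lpMap T g) = lpMap (innerSL ℂ (ContinuousLinearMap.adjoint T e)) g := by
  ext i; simp [ContinuousLinearMap.adjoint_inner_left]

end HilbertSum

/-! ### Lifting Gram representations to the Hilbert space of a kernel -/

section Lift

variable {H : Type u} [NormedAddCommGroup H] [InnerProductSpace ℂ H] [CompleteSpace H]
variable {S : Type v} {κ : S → S → (H →L[ℂ] H)} {G : Type*} [NormedAddCommGroup G]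
  [InnerProductSpace ℂ G] [CompleteSpace G]

/-- The map `s ⊗ h ↦ τ_s h` on finitely supported functions. -/
def kliftPre (hκ : PosDefKernel κ) (τ : S → (H →L[ℂ] G)) : KPre hκ →ₗ[ℂ] G :=
  Finsupp.lsum ℂ fun s => (τ s).toLinearMap

lemma kliftPre_vec (hκ : PosDefKernel κ) (τ : S → (H →L[ℂ] G)) (s : S) (h : H) :
    kliftPre hκ τ (kpreVec hκ s h) = τ s h := by
  exact Finsupp.sum_single_index (map_zero (τ s))

lemma kliftPre_inner (hκ : PosDefKernel κ) (τ : S → (H →L[ℂ] G))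
    (hτ : ∀ s t h k, ⟪τ s h, τ t k⟫_ℂ = ⟪h, κ s t k⟫_ℂ) (f g : KPre hκ) :
    ⟪kliftPre hκ τ f, kliftPre hκ τ g⟫_ℂ = ⟪f, g⟫_ℂ := by
  rw [kpre_inner]
  change ⟪Finsupp.sum (f : S →₀ H) (fun s h => τ s h), Finsupp.sum (g : S →₀ H) (fun s h => τ s h)⟫_ℂ = _
  simp only [kform, Finsupp.sum, sum_inner, inner_sum, hτ]
  exact Finset.sum_comm

/-- A family of operators whose Gram kernel is `κ` defines an isometry on the Hilbert space
of `κ`. -/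
def klift (hκ : PosDefKernel κ) (τ : S → (H →L[ℂ] G))
    (hτ : ∀ s t h k, ⟪τ s h, τ t k⟫_ℂ = ⟪h, κ s t k⟫_ℂ) : KSpace hκ →ₗᵢ[ℂ] G :=
  have hn : ∀ f, ‖kliftPre hκ τ f‖ = ‖f‖ := fun f => by
    rw [norm_eq_sqrt_re_inner (𝕜 := ℂ), norm_eq_sqrt_re_inner (𝕜 := ℂ), kliftPre_inner hκ τ hτ]
  let T : KSpace hκ →L[ℂ] G :=
    ((kliftPre hκ τ).mkContinuous 1 fun f => by rw [hn, one_mul]).extend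
      (Completion.toComplL (𝕜 := ℂ) (E := KPre hκ))
  have hT : ∀ f : KPre hκ, T (f : KSpace hκ) = kliftPre hκ τ f := fun f =>
    ContinuousLinearMap.extend_eq _ Completion.denseRange_coe
      (Completion.isUniformInducing_coe _) f
  { T.toLinearMap with
    norm_map' := fun g => by
      change ‖T g‖ = ‖g‖
      induction g using Completion.induction_on with
      | hp => exact isClosed_eq (by fun_prop) (by fun_prop)
      | ih f => rw [hT, hn, Completion.norm_coe] }

lemma klift_kvec (hκ : PosDefKernel κ) (τ : S → (H →L[ℂ] G))
    (hτ : ∀ s t h k, ⟪τ s h, τ t k⟫_ℂ = ⟪h, κ s t k⟫_ℂ) (s : S) (h : H) :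
    klift hκ τ hτ (kvec hκ s h) = τ s h := by
  rw [kvec_apply, ← kliftPre_vec hκ τ]
  exact ContinuousLinearMap.extend_eq _ Completion.denseRange_coe
      (Completion.isUniformInducing_coe _) _

end Lift

/-! ### Kernels of the form `K(z,w)(a) = L_z* (1 ⊗ a) L_w` -/

section Factored

variable {H : Type u} [NormedAddCommGroup H] [InnerProductSpace ℂ H] [CompleteSpace H]
variable {ι : Type v}

/-- On the ball of radius `r` the series of coordinate inner products is dominated by `|r| ‖g i‖ ‖g'
i‖`, which is summable by Hölder. The convergence is therefore uniform there, and each term is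
continuous in the weak operator topology. -/
lemma inner_lpMap_continuousOn (r : ℝ) (g g' : HilbSum ι H) :
    ContinuousOn (fun a : H →WOT[ℂ] H => ⟪g, lpMap (toCLM a) g'⟫_ℂ)
      {a : H →WOT[ℂ] H | ‖toCLM a‖ ≤ r} := by
  have hs : Summable fun i => |r| * (‖g i‖ * ‖g' i‖) :=
    (Real.summable_mul_of_Lp_Lq_of_nonneg (p := 2) (q := 2)
      (by rw [Real.holderConjugate_iff]; norm_num) (fun i => norm_nonneg _) (fun i => norm_nonneg _)
      (by simpa using (lp_norm_sq g).summable)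
      (by simpa using (lp_norm_sq g').summable)).mul_left _
  simp only [lp.inner_eq_tsum, lpMap_apply]
  refine continuousOn_tsum (fun i => ?_) hs fun i a ha => ?_
  · exact (ContinuousLinearMapWOT.continuous_iff.mp continuous_id (g' i) (g i)).continuousOn
  · refine (norm_inner_le_norm _ _).trans ?_
    have h1 : ‖toCLM a (g' i)‖ ≤ |r| * ‖g' i‖ :=
      ((toCLM a).le_opNorm _).trans (by gcongr; exact ha.trans (le_abs_self r))
    calc _ ≤ ‖g i‖ * (|r| * ‖g' i‖) := by gcongr
      _ = _ := by ring

lemma isNormalMap_lpMap (A B : H →L[ℂ] HilbSum ι H) :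
    IsNormalMap fun a => ContinuousLinearMap.adjoint A ∘L lpMap a ∘L B := by
  refine ⟨⟨⟨fun a b => ?_, fun c a => ?_⟩, ?_⟩, fun r => ?_⟩
  · have : (lpMap (a + b) : HilbSum ι H →L[ℂ] HilbSum ι H) = lpMap a + lpMap b := by ext; simp
    rw [this, ContinuousLinearMap.add_comp, ContinuousLinearMap.comp_add]
  · have : (lpMap (c • a) : HilbSum ι H →L[ℂ] HilbSum ι H) = c • lpMap a := by ext; simp
    rw [this, ContinuousLinearMap.smul_comp, ContinuousLinearMap.comp_smul]
  -- `IsBoundedLinearMap` asks for a strictly positive constant; the summand 1 covers `A = 0` or `B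
  -- = 0`.
  · refine ⟨‖A‖ * ‖B‖ + 1, by positivity, fun a => ?_⟩
    have h1 := ContinuousLinearMap.opNorm_comp_le (ContinuousLinearMap.adjoint A) (lpMap a ∘L B)
    have h2 := ContinuousLinearMap.opNorm_comp_le (lpMap a) B
    rw [LinearIsometryEquiv.norm_map] at h1
    calc _ ≤ ‖A‖ * (‖a‖ * ‖B‖) :=
          h1.trans (by gcongr; exact h2.trans (by gcongr; exact lpMap_norm_le a))
      _ ≤ _ := by nlinarith [norm_nonneg a]
  · refine ContinuousLinearMapWOT.continuousOn_iff.mpr fun h k => ?_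
    refine (inner_lpMap_continuousOn r (A k) (B h)).congr fun a _ => ?_
    rw [ContinuousLinearMapWOT.ofCLM_apply, ContinuousLinearMap.comp_apply,
      ContinuousLinearMap.adjoint_inner_right]
    rfl

variable {Z : Type u} {K : Z → Z → (H →L[ℂ] H) → (H →L[ℂ] H)} {L : Z → (H →L[ℂ] HilbSum ι H)}

lemma inner_factored (hL : ∀ z w a, K z w a = ContinuousLinearMap.adjoint (L z) ∘L lpMap a ∘L L w)
    (z w : Z) (a : H →L[ℂ] H) (h k : H) : ⟪h, K z w a k⟫_ℂ = ⟪L z h, lpMap a (L w k)⟫_ℂ := by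
  rw [hL, ContinuousLinearMap.comp_apply, ContinuousLinearMap.adjoint_inner_right]
  rfl

/-- The operator `1 ⊗ a` acts in each coordinate separately, so the quadratic form of the image
matrix is the sum over `i` of the quadratic form of `A` at the vectors `L (z p.2) (x p) i`, each
nonnegative. -/
lemma isCPKernel_of_factored
    (hL : ∀ z w a, K z w a = ContinuousLinearMap.adjoint (L z) ∘L lpMap a ∘L L w) :
    IsCPKernel K where
  normal z w := by
    rw [funext (hL z w)]
    exact isNormalMap_lpMap _ _
  cp n m z A hA x := by
    simp only [inner_factored hL]
    have h1 : HasSum (fun i => ∑ p, ∑ q, ⟪L (z p.2) (x p) i, A p q (L (z q.2) (x q) i)⟫_ℂ)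
        (∑ p, ∑ q, ⟪L (z p.2) (x p), lpMap (A p q) (L (z q.2) (x q))⟫_ℂ) :=
      hasSum_sum fun p _ => hasSum_sum fun q _ => lp.hasSum_inner _ _
    exact h1.nonneg fun i => hA fun p => L (z p.2) (x p) i

/-- The isometry `k_{(a,w)} ⊗ h ↦ (1 ⊗ a*) L_w h`. -/
def rkIso (hK : IsCPKernel K)
    (hL : ∀ z w a, K z w a = ContinuousLinearMap.adjoint (L z) ∘L lpMap a ∘L L w) :
    RKSpace hK →ₗᵢ[ℂ] HilbSum ι H :=
  klift (rkGram_posDef hK) (fun s => lpMap (star s.1) ∘L L s.2) fun s t h k => by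
    rw [rkGram, inner_factored hL, ContinuousLinearMap.comp_apply, ContinuousLinearMap.comp_apply,
      inner_lpMap_left, lpMap_comp, ContinuousLinearMap.star_eq_adjoint,
      ContinuousLinearMap.adjoint_adjoint, ContinuousLinearMap.star_eq_adjoint]
    rfl

variable [Nontrivial H] (hK : IsCPKernel K)
    (hL : ∀ z w a, K z w a = ContinuousLinearMap.adjoint (L z) ∘L lpMap a ∘L L w)

/-- The isometry `x ⊗ h ↦ x h` on `E_K ⊗ H`, followed by `rkIso`. -/
def corrIso : (rkCorr hK).Tensor →ₗᵢ[ℂ] HilbSum ι H :=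
  klift (rkCorr hK).posDef (fun x => (rkIso hK hL).toContinuousLinearMap ∘L rkOp hK x)
    fun x y h k => by
      refine ((rkIso hK hL).inner_map_map _ _).trans ?_
      exact (ContinuousLinearMap.adjoint_inner_right (rkOp hK x) h (rkOp hK y k)).symm

lemma corrIso_tmul (x : (rkCorr hK).carrier) (h : H) :
    corrIso hK hL ((rkCorr hK).tmul x h) = rkIso hK hL (rkOp hK x h) :=
  klift_kvec _ _ _ x h

lemma rkIso_rkVec (a : H →L[ℂ] H) (w : Z) (h : H) :
    rkIso hK hL (rkVec hK a w h) = lpMap (star a) (L w h) :=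
  klift_kvec _ _ _ (a, w) h

/-- Both sides are continuous, and on generators the identity is `(a b*)* = b a*`. -/
lemma rkIso_rkRep (b : H →L[ℂ] H) (g : RKSpace hK) :
    rkIso hK hL (rkRep hK b g) = lpMap b (rkIso hK hL g) := by
  refine kspace_span (rkGram_posDef hK) (LinearMap.eqLocus
    ((rkIso hK hL).toLinearMap ∘ₗ (rkRep hK b).toLinearMap)
    ((lpMap b).toLinearMap ∘ₗ (rkIso hK hL).toLinearMap)) ?_ (fun s x => ?_) g
  · exact isClosed_eq ((rkIso hK hL).continuous.comp (rkRep hK b).continuous)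
      ((lpMap b).continuous.comp (rkIso hK hL).continuous)
  · change rkIso hK hL (rkRep hK b (rkVec hK s.1 s.2 x)) = lpMap b (rkIso hK hL (rkVec hK s.1 s.2 x))
    have : rkRep hK b (rkVec hK s.1 s.2 x) = rkVec hK (s.1 * star b) s.2 x :=
      kact_kvec _ (rkShift_action hK) b s x
    rw [this, rkIso_rkVec, rkIso_rkVec, lpMap_comp, star_mul, star_star]
    rfl

lemma corrIso_lactTensor (b : H →L[ℂ] H) (g : (rkCorr hK).Tensor) :
    corrIso hK hL ((rkCorr hK).lactTensor b g) = lpMap b (corrIso hK hL g) := by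
  refine kspace_span (rkCorr hK).posDef (LinearMap.eqLocus
    ((corrIso hK hL).toLinearMap ∘ₗ ((rkCorr hK).lactTensor b).toLinearMap)
    ((lpMap b).toLinearMap ∘ₗ (corrIso hK hL).toLinearMap)) ?_ (fun s x => ?_) g
  · exact isClosed_eq ((corrIso hK hL).continuous.comp ((rkCorr hK).lactTensor b).continuous)
      ((lpMap b).continuous.comp (corrIso hK hL).continuous)
  · change corrIso hK hL ((rkCorr hK).lactTensor b ((rkCorr hK).tmul s x)) =
      lpMap b (corrIso hK hL ((rkCorr hK).tmul s x))
    rw [WStarCorr.lactTensor_tmul, corrIso_tmul, corrIso_tmul, ← rkIso_rkRep]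
    rfl

/-- The range of `corrIso` as a closed subspace. -/
lemma corrIso_isClosed_range :
    IsClosed (LinearMap.range (corrIso hK hL).toLinearMap : Set (HilbSum ι H)) :=
  (corrIso hK hL).isometry.isClosedEmbedding.isClosed_range

lemma mem_range_corrIso (w : Z) (h : H) :
    L w h ∈ LinearMap.range (corrIso hK hL).toLinearMap := by
  refine ⟨(rkCorr hK).tmul (rkKernel hK 1 w) h, ?_⟩
  change corrIso hK hL _ = _
  rw [corrIso_tmul]
  refine (rkIso_rkVec hK hL 1 w h).trans ?_
  rw [star_one]
  rfl

/-- Slicing `(1 ⊗ a*) L_w h` at `e` is slicing `L_w h` at `a e`, so the condition on the `L_w` alone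
controls all generators, and closedness of `M` does the rest. The argument runs twice: over
`RKSpace`, then over the tensor product. -/
lemma slice_corrIso_mem (M : Submodule ℂ (HilbSum ι ℂ)) (hM : IsClosed (M : Set (HilbSum ι ℂ)))
    (hs : ∀ w (e h : H), lpMap (innerSL ℂ e) (L w h) ∈ M) (e : H) (g : (rkCorr hK).Tensor) :
    lpMap (innerSL ℂ e) (corrIso hK hL g) ∈ M := by
  have h1 : ∀ g : RKSpace hK, lpMap (innerSL ℂ e) (rkIso hK hL g) ∈ M := fun g => by
    refine kspace_span (rkGram_posDef hK) (M.comap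
      ((lpMap (innerSL ℂ e)).toLinearMap ∘ₗ (rkIso hK hL).toLinearMap)) ?_ (fun s x => ?_) g
    · exact hM.preimage ((lpMap (innerSL ℂ e)).continuous.comp (rkIso hK hL).continuous)
    · change lpMap (innerSL ℂ e) (rkIso hK hL (rkVec hK s.1 s.2 x)) ∈ M
      rw [rkIso_rkVec, lpMap_innerSL_lpMap]
      exact hs _ _ _
  refine kspace_span (rkCorr hK).posDef (M.comap
    ((lpMap (innerSL ℂ e)).toLinearMap ∘ₗ (corrIso hK hL).toLinearMap)) ?_ (fun s x => ?_) g
  · exact hM.preimage ((lpMap (innerSL ℂ e)).continuous.comp (corrIso hK hL).continuous)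
  · change lpMap (innerSL ℂ e) (corrIso hK hL ((rkCorr hK).tmul s x)) ∈ M
    rw [corrIso_tmul]
    exact h1 _

/-- The rank-one operator `b = |h⟩⟨e|` satisfies `b e = h`, so `Y h = Y b e = (b ⊗ I) Y e`: the
whole of `Y` is determined by `Y e`. Under `corrIso` the right side is `1 ⊗ |h⟩⟨e|` applied to a
vector, which is its `e`-slice tensored with `h`. -/
lemma corrIso_sigmaDual (Y : (rkCorr hK).sigmaDual) {e : H} (he : ‖e‖ = 1) (h : H) :
    corrIso hK hL (Y.1 h) = tensorVec (lpMap (innerSL ℂ e) (corrIso hK hL (Y.1 e))) h := by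
  have h1 : Y.1 (InnerProductSpace.rankOne ℂ h e e) =
      (rkCorr hK).lactTensor (InnerProductSpace.rankOne ℂ h e) (Y.1 e) :=
    DFunLike.congr_fun (Y.2 (InnerProductSpace.rankOne ℂ h e)) e
  have h2 : InnerProductSpace.rankOne ℂ h e e = h := by
    simp [InnerProductSpace.rankOne_apply, inner_self_eq_norm_sq_to_K, he]
  rw [h2] at h1
  rw [h1, corrIso_lactTensor, lpMap_rankOne]

/-- If all vectors `ξ ⊗ h` lie in the range of `corrIso`, then `ξ` defines an element of the
`σ`-dual. -/
lemma exists_sigmaDual (ξ : HilbSum ι ℂ)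
    (hξ : ∀ h : H, tensorVec ξ h ∈ LinearMap.range (corrIso hK hL).toLinearMap) :
    ∃ Y : (rkCorr hK).sigmaDual, ∀ h, corrIso hK hL (Y.1 h) = tensorVec ξ h := by
  choose y hy using hξ
  have hy' : ∀ h, corrIso hK hL (y h) = tensorVec ξ h := hy
  have inj := (corrIso hK hL).injective
  refine ⟨⟨LinearMap.mkContinuous ⟨⟨y, fun h k => inj ?_⟩, fun c h => inj ?_⟩
    ‖(tensorVec ξ : H →L[ℂ] HilbSum ι H)‖ fun h => ?_, fun b => ?_⟩, hy'⟩
  · simp [hy']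
  · simp [hy']
  · change ‖y h‖ ≤ _
    rw [← (corrIso hK hL).norm_map, hy']
    exact ContinuousLinearMap.le_opNorm _ _
  · ext h
    refine inj ?_
    change corrIso hK hL (y (b h)) = corrIso hK hL ((rkCorr hK).lactTensor b (y h))
    rw [corrIso_lactTensor, hy', hy', lpMap_tensorVec]

lemma WStarCorr.inner_sigmaDualInner (F : WStarCorr H) (Y Y' : F.sigmaDual) (k h : H) :
    ⟪k, F.sigmaDualInner Y Y' h⟫_ℂ = ⟪Y.1 k, Y'.1 h⟫_ℂ := by
  rw [WStarCorr.sigmaDualInner, ContinuousLinearMap.comp_apply,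
    ContinuousLinearMap.adjoint_inner_right]

lemma sigmaDualInner_eq {Y Y' : (rkCorr hK).sigmaDual} {ξ η : HilbSum ι ℂ}
    (hY : ∀ h, corrIso hK hL (Y.1 h) = tensorVec ξ h)
    (hY' : ∀ h, corrIso hK hL (Y'.1 h) = tensorVec η h) :
    (rkCorr hK).sigmaDualInner Y Y' = ⟪ξ, η⟫_ℂ • ContinuousLinearMap.id ℂ H := by
  refine ContinuousLinearMap.ext fun h => ext_inner_left ℂ fun k => ?_
  rw [WStarCorr.inner_sigmaDualInner, ← (corrIso hK hL).inner_map_map, hY, hY', inner_tensorVec,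
    smul_apply, inner_smul_right, ContinuousLinearMap.id_apply]

/-- Computation of the `σ`-dual for a factored kernel: it is the closed space `M` of coefficient
sequences, provided `M` contains the slices of all `L_w h` and is spanned by sequences `ξ` for which
some `L_w` is `h ↦ ξ ⊗ h`. -/
theorem exists_sigmaDual_equiv
    (hL : ∀ z w a, K z w a = ContinuousLinearMap.adjoint (L z) ∘L lpMap a ∘L L w)
    (M : Submodule ℂ (HilbSum ι ℂ))
    (hM : IsClosed (M : Set (HilbSum ι ℂ)))
    (hs : ∀ w (e h : H), lpMap (innerSL ℂ e) (L w h) ∈ M)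
    (hd : M ≤ (Submodule.span ℂ {ξ | ∃ w, ∀ h, L w h = tensorVec ξ h}).topologicalClosure) :
    ∃ Ψ : M ≃ₗ[ℂ] (rkCorr hK).sigmaDual, ∀ ξ η : M,
      (rkCorr hK).sigmaDualInner (Ψ ξ) (Ψ η) = ⟪ξ, η⟫_ℂ • ContinuousLinearMap.id ℂ H := by
  obtain ⟨e, he⟩ := exists_norm_eq H zero_le_one
  have hee : ⟪e, e⟫_ℂ = 1 := by simp [inner_self_eq_norm_sq_to_K, he]
  have hMr : ∀ ξ ∈ M, ∀ h : H, tensorVec ξ h ∈ LinearMap.range (corrIso hK hL).toLinearMap := by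
    intro ξ hξ h
    let ρ : HilbSum ι ℂ →L[ℂ] HilbSum ι H := lpMap (ContinuousLinearMap.toSpanSingleton ℂ h)
    have hcl : IsClosed ((LinearMap.range (corrIso hK hL).toLinearMap).comap ρ.toLinearMap :
        Set (HilbSum ι ℂ)) := (corrIso_isClosed_range hK hL).preimage ρ.continuous
    -- The map `ξ ↦ ξ ⊗ h` is bounded and an isometry has closed range, so only the generators `ξ`
    -- with `L_w = ξ ⊗ ·` need checking.
    refine Submodule.topologicalClosure_minimal _ (Submodule.span_le.mpr ?_) hcl (hd hξ)
    rintro η ⟨w, hw⟩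
    change tensorVec η h ∈ LinearMap.range (corrIso hK hL).toLinearMap
    rw [← hw]
    exact mem_range_corrIso hK hL w h
  have key : ∀ ξ : M, ∃ Y : (rkCorr hK).sigmaDual, ∀ h, corrIso hK hL (Y.1 h) = tensorVec ξ.1 h :=
    fun ξ => exists_sigmaDual hK hL ξ.1 (hMr ξ.1 ξ.2)
  choose Ψ hΨ using key
  have inj := (corrIso hK hL).injective
  have hsl : ∀ ξ : HilbSum ι ℂ, lpMap (innerSL ℂ e) (tensorVec ξ e) = ξ := fun ξ => by
    ext i; simp [he, inner_smul_right]
  have hip : ∀ ξ η : M,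
      (rkCorr hK).sigmaDualInner (Ψ ξ) (Ψ η) = ⟪ξ, η⟫_ℂ • ContinuousLinearMap.id ℂ H := fun ξ η => by
    exact sigmaDualInner_eq hK hL (hΨ ξ) (hΨ η)
  let Ψl : M →ₗ[ℂ] (rkCorr hK).sigmaDual :=
    { toFun := Ψ
      map_add' := fun ξ η => Subtype.ext (ContinuousLinearMap.ext fun h => inj (by
        change _ = corrIso hK hL ((Ψ ξ).1 h + (Ψ η).1 h)
        simp [hΨ]))
      map_smul' := fun c ξ => Subtype.ext (ContinuousLinearMap.ext fun h => inj (by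
        change _ = corrIso hK hL (c • (Ψ ξ).1 h)
        simp [hΨ])) }
  refine ⟨LinearEquiv.ofBijective Ψl ⟨fun ξ η h => ?_, fun Y => ?_⟩, fun ξ η => ?_⟩
  · have h1 : Ψ ξ = Ψ η := h
    refine Subtype.ext ?_
    rw [← hsl ξ.1, ← hsl η.1, ← hΨ, ← hΨ, h1]
  -- Surjectivity: the preimage of `Y` is the `e`-slice of the image of `Y e`.
  · refine ⟨⟨_, slice_corrIso_mem hK hL M hM hs e (Y.1 e)⟩, ?_⟩
    refine Subtype.ext (ContinuousLinearMap.ext fun h => inj ?_)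
    rw [corrIso_sigmaDual hK hL Y he h]
    exact hΨ _ h
  · exact hip ξ η

end Factored

/-! ### The square roots `R_k` -/

section Roots

variable {d : ℕ}

/-- This is the Schur product theorem, iterated. The empty product is the all-ones matrix, of rank
one. -/
lemma posSemidef_prod {n : Type*} {ι : Type*} [Finite n] (s : Finset ι) (M : ι → Matrix n n ℂ)
    (hM : ∀ i, (M i).PosSemidef) :
    (Matrix.of fun α β => ∏ i ∈ s, M i α β : Matrix n n ℂ).PosSemidef := by
  classical
  have := Fintype.ofFinite n
  induction s using Finset.induction_on with
  | empty =>
    have : (Matrix.of fun α β => ∏ i ∈ (∅ : Finset ι), M i α β : Matrix n n ℂ) =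
        Matrix.vecMulVec 1 (star 1) := by
      ext; simp [Matrix.vecMulVec_apply]
    rw [this]
    exact Matrix.posSemidef_vecMulVec_self_star 1
  | insert i s hi ih =>
    have : (Matrix.of fun α β => ∏ j ∈ insert i s, M j α β : Matrix n n ℂ) =
        Matrix.hadamard (M i) (Matrix.of fun α β => ∏ j ∈ s, M j α β) := by
      ext; simp [Finset.prod_insert hi]
    rw [this]
    exact (hM i).hadamard ih

/-- The summand `X_{k₁} ⊗ ⋯ ⊗ X_{k_l}` of `R_k²`. -/
def compMatrix (X : ∀ k : ℕ, WordMatrix d k) {k : ℕ} (c : Composition k) : WordMatrix d k :=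
  Matrix.of fun α β => ∏ i : Fin c.length,
    X (c.blocksFun i) (α ∘ c.embedding i) (β ∘ c.embedding i)

lemma Rsq_eq_sum (X : ∀ k : ℕ, WordMatrix d k) (k : ℕ) :
    Rsq X k = ∑ c : Composition k, compMatrix X c := by
  ext α β
  simp [Rsq, compMatrix, Matrix.sum_apply]

/-- A Kronecker product is the entrywise product of its factors, each pulled back to words of length
`k` by restriction to its block. -/
lemma compMatrix_posSemidef {X : ∀ k : ℕ, WordMatrix d k}
    (hX : ∀ k, 1 ≤ k → (X k).PosSemidef) {k : ℕ} (c : Composition k) :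
    (compMatrix X c).PosSemidef :=
  posSemidef_prod Finset.univ
    (fun i => (X (c.blocksFun i)).submatrix (· ∘ c.embedding i) (· ∘ c.embedding i))
    fun i => (hX _ (c.one_le_blocksFun i)).submatrix _

lemma Rsq_posSemidef {X : ∀ k : ℕ, WordMatrix d k}
    (hX : ∀ k, 1 ≤ k → (X k).PosSemidef) (k : ℕ) : (Rsq X k).PosSemidef := by
  rw [Rsq_eq_sum]
  exact Matrix.posSemidef_sum _ fun c _ => compMatrix_posSemidef hX c

lemma exists_eq_conjTranspose_mul_self {n : Type*} [Fintype n] {M : Matrix n n ℂ}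
    (hM : M.PosSemidef) : ∃ R : Matrix n n ℂ, M = R.conjTranspose * R := by
  classical
  open scoped MatrixOrder in
  exact CStarAlgebra.nonneg_iff_eq_star_mul_self.mp hM.nonneg

lemma wordOp_conjTranspose_mul {k : ℕ} (R : WordMatrix d k) :
    wordOp (R.conjTranspose * R) = star (wordOp R) * wordOp R := by
  rw [wordOp, ← Matrix.star_eq_conjTranspose, map_mul, map_star]; rfl

lemma wordOp_nonneg {k : ℕ} {M : WordMatrix d k} (hM : M.PosSemidef) : 0 ≤ wordOp M := by
  obtain ⟨R, rfl⟩ := exists_eq_conjTranspose_mul_self hM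
  rw [wordOp_conjTranspose_mul]
  exact star_mul_self_nonneg _

/-- The matrix of `R_k`. -/
def Rmat (X : ∀ k : ℕ, WordMatrix d k) (k : ℕ) : WordMatrix d k :=
  (Matrix.toEuclideanCLM (n := Word d k) (𝕜 := ℂ)).symm (Rop X k)

lemma wordOp_Rmat (X : ∀ k : ℕ, WordMatrix d k) (k : ℕ) : wordOp (Rmat X k) = Rop X k :=
  StarAlgEquiv.apply_symm_apply _ _

lemma Rop_apply (X : ∀ k : ℕ, WordMatrix d k) (k : ℕ) (v : TensorPow d k) (γ : Word d k) :
    Rop X k v γ = ∑ α, Rmat X k γ α * v α := by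
  rw [← wordOp_Rmat, wordOp, Matrix.ofLp_toEuclideanCLM]
  rfl

lemma Rop_adj (X : ∀ k : ℕ, WordMatrix d k) (k : ℕ) (v w : TensorPow d k) :
    ⟪Rop X k v, w⟫_ℂ = ⟪v, Rop X k w⟫_ℂ := by
  have h : IsSelfAdjoint (Rop X k) := IsSelfAdjoint.of_nonneg (CFC.sqrt_nonneg (wordOp (Rsq X k)))
  rw [← ContinuousLinearMap.adjoint_inner_right, ← ContinuousLinearMap.star_eq_adjoint, h.star_eq]

lemma Rmat_mul_self {X : ∀ k : ℕ, WordMatrix d k}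
    (hX : ∀ k, 1 ≤ k → (X k).PosSemidef) (k : ℕ) :
    (Rmat X k).conjTranspose * Rmat X k = Rsq X k := by
  have h : IsSelfAdjoint (Rop X k) := IsSelfAdjoint.of_nonneg (CFC.sqrt_nonneg (wordOp (Rsq X k)))
  have h1 : Rop X k * Rop X k = wordOp (Rsq X k) :=
    CFC.sqrt_mul_sqrt_self _ (wordOp_nonneg (Rsq_posSemidef hX k))
  refine (Matrix.toEuclideanCLM (n := Word d k) (𝕜 := ℂ)).injective ?_
  refine (wordOp_conjTranspose_mul (Rmat X k)).trans ?_
  rw [wordOp_Rmat, h.star_eq, h1]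
  rfl

end Roots

/-! ### The maps `a ↦ V^{(k)} (M ⊗ a) W^{(k)*}` -/

section HomTerm

variable {H : Type u} [NormedAddCommGroup H] [InnerProductSpace ℂ H] [CompleteSpace H] {d : ℕ}

lemma inner_self_eq_ofReal (h : H) : ⟪h, h⟫_ℂ = ((‖h‖ ^ 2 : ℝ) : ℂ) := by
  rw [inner_self_eq_norm_sq_to_K]
  push_cast
  rfl

/-- The row of `(R ⊗ I) T^{(k)*}` at the word `γ`. -/
def rowOp {k : ℕ} (R : WordMatrix d k) (T : Fin d → (H →L[ℂ] H)) (γ : Word d k) : H →L[ℂ] H :=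
  ∑ α, R γ α • star (wordProd T α)

/-- A factorization of the weight splits the term into conjugations `A* a B`. With an arbitrary
factor this yields positivity of `homTerm`; with `R = R_k` it yields the factorization of the
kernel. -/
lemma homTerm_conjTranspose_mul {k : ℕ} (R : WordMatrix d k) (V W : Fin d → (H →L[ℂ] H))
    (a : H →L[ℂ] H) :
    homTerm (R.conjTranspose * R) V W a = ∑ γ, star (rowOp R V γ) * a * rowOp R W γ := by
  change ∑ α, ∑ β, (∑ γ, star (R γ α) * R γ β) • (wordProd V α * a * star (wordProd W β)) = _
  simp_rw [rowOp, star_sum, Finset.sum_mul, Finset.mul_sum, Finset.sum_smul]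
  conv_rhs => rw [Finset.sum_comm]
  refine Finset.sum_congr rfl fun β _ => ?_
  rw [Finset.sum_comm]
  refine Finset.sum_congr rfl fun γ _ => Finset.sum_congr rfl fun α _ => ?_
  simp only [star_smul, star_star, smul_mul_assoc, mul_smul_comm,
    smul_smul]
  rw [mul_comm]

lemma homTerm_sub {k : ℕ} (M : WordMatrix d k) (V W : Fin d → (H →L[ℂ] H)) (a b : H →L[ℂ] H) :
    homTerm M V W (a - b) = homTerm M V W a - homTerm M V W b := by
  simp only [homTerm, mul_sub, sub_mul, smul_sub, Finset.sum_sub_distrib]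

lemma homTerm_sum {k : ℕ} (M : WordMatrix d k) (V W : Fin d → (H →L[ℂ] H)) {ι : Type*}
    (s : Finset ι) (a : ι → (H →L[ℂ] H)) :
    homTerm M V W (∑ i ∈ s, a i) = ∑ i ∈ s, homTerm M V W (a i) := by
  let φ : (H →L[ℂ] H) →+ (H →L[ℂ] H) := AddMonoidHom.ofMapSub (homTerm M V W) (homTerm_sub M V W)
  exact map_sum φ a s

lemma homTerm_smul {k : ℕ} (M : WordMatrix d k) (V W : Fin d → (H →L[ℂ] H)) (c : ℂ)
    (a : H →L[ℂ] H) : homTerm M V W (c • a) = c • homTerm M V W a := by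
  simp only [homTerm, mul_smul_comm, smul_mul_assoc, Finset.smul_sum, smul_comm c]

lemma homTerm_matrix_sum {k : ℕ} {ι : Type*} (s : Finset ι) (M : ι → WordMatrix d k)
    (V W : Fin d → (H →L[ℂ] H)) (a : H →L[ℂ] H) :
    homTerm (∑ i ∈ s, M i) V W a = ∑ i ∈ s, homTerm (M i) V W a := by
  simp only [homTerm, Matrix.sum_apply, Finset.sum_smul]
  rw [Finset.sum_comm]
  conv_rhs => rw [Finset.sum_comm]
  simp_rw [Finset.sum_comm (s := s)]
  exact Finset.sum_comm

lemma homTerm_nonneg {k : ℕ} {M : WordMatrix d k} (hM : M.PosSemidef) (T : Fin d → (H →L[ℂ] H))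
    {a : H →L[ℂ] H} (ha : 0 ≤ a) : 0 ≤ homTerm M T T a := by
  obtain ⟨R, rfl⟩ := exists_eq_conjTranspose_mul_self hM
  rw [homTerm_conjTranspose_mul]
  exact Finset.sum_nonneg fun γ _ => star_left_conjugate_nonneg ha _

lemma homTerm_mono {k : ℕ} {M : WordMatrix d k} (hM : M.PosSemidef) (T : Fin d → (H →L[ℂ] H))
    {a b : H →L[ℂ] H} (hab : a ≤ b) : homTerm M T T a ≤ homTerm M T T b := by
  rw [← sub_nonneg, ← homTerm_sub]
  exact homTerm_nonneg hM T (sub_nonneg.mpr hab)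

lemma le_iff_inner_le {a b : H →L[ℂ] H} : a ≤ b ↔ ∀ h, ⟪h, a h⟫_ℂ ≤ ⟪h, b h⟫_ℂ := by
  rw [ContinuousLinearMap.le_def]
  refine ⟨fun hp h => ?_, fun hp => ?_⟩
  · have := hp.inner_nonneg_right h
    rwa [sub_apply, inner_sub_right, sub_nonneg] at this
  · refine (ContinuousLinearMap.isPositive_iff_complex _).mpr fun h => ?_
    have h1 : 0 ≤ ⟪(b - a) h, h⟫_ℂ := by
      have := hp h
      rw [← sub_nonneg, ← inner_sub_right, ← sub_apply] at this
      rw [← inner_conj_symm]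
      exact (starRingEnd ℂ).map_zero ▸ star_le_star_iff.mpr this
    obtain ⟨h2, h3⟩ := Complex.nonneg_iff.mp h1
    exact ⟨Complex.ext rfl h3, h2⟩

/-! ### Words and commuting tuples -/

/-- Lifting the tuple to the commutative submonoid it generates makes `Finset` products available
for `T_α`, so that they can be permuted and regrouped freely. -/
lemma exists_commMonoid_hom {T : Fin d → (H →L[ℂ] H)} (hT : ∀ i j, T i * T j = T j * T i) :
    ∃ (A : Type u) (_ : CommMonoid A) (f : A →* (H →L[ℂ] H)) (t : Fin d → A), ∀ i, f (t i) = T i := by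
  have h : IsMulCommutative (Submonoid.closure (Set.range T)) := by
    refine Submonoid.isMulCommutative_closure _ ?_
    rintro _ ⟨i, rfl⟩ _ ⟨j, rfl⟩
    exact hT i j
  open scoped IsMulCommutative in
  exact ⟨Submonoid.closure (Set.range T), inferInstance, (Submonoid.closure (Set.range T)).subtype,
    fun i => ⟨T i, Submonoid.subset_closure ⟨i, rfl⟩⟩, fun i => rfl⟩

lemma wordProd_eq_prod {A : Type*} [CommMonoid A] (f : A →* (H →L[ℂ] H)) {t : Fin d → A}
    {T : Fin d → (H →L[ℂ] H)} (ht : ∀ i, f (t i) = T i) {k : ℕ} (α : Word d k) :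
    wordProd T α = f (∏ i, t (α i)) := by
  rw [wordProd, ← List.prod_ofFn, map_list_prod, List.map_ofFn]
  simp [Function.comp_def, ht]

lemma wordProd_comp_perm {T : Fin d → (H →L[ℂ] H)} (hT : ∀ i j, T i * T j = T j * T i) {k : ℕ}
    (α : Word d k) (π : Equiv.Perm (Fin k)) : wordProd T (α ∘ π) = wordProd T α := by
  obtain ⟨A, _, f, t, ht⟩ := exists_commMonoid_hom hT
  rw [wordProd_eq_prod f ht, wordProd_eq_prod f ht]
  exact congrArg f (Equiv.prod_comp π fun i => t (α i))

/-- The composition of the maps `a ↦ T^{(j)} (X_j ⊗ a) T^{(j)*}` over a list of indices `j`. -/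
def iterTerm (X : ∀ k : ℕ, WordMatrix d k) (T : Fin d → (H →L[ℂ] H)) (l : List ℕ) :
    H →L[ℂ] H :=
  l.foldr (fun j a => homTerm (X j) T T a) 1

/-- Induction on the number of blocks: the first block contributes the outermost map, since its
letters stand leftmost in `T_α` and rightmost in `T_β*`. -/
lemma sum_pi_eq_iterTerm (X : ∀ k : ℕ, WordMatrix d k) {T : Fin d → (H →L[ℂ] H)} {A : Type*}
    [CommMonoid A] (f : A →* (H →L[ℂ] H)) {t : Fin d → A} (ht : ∀ i, f (t i) = T i) :
    ∀ (n : ℕ) (b : Fin n → ℕ),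
      ∑ α : ∀ i, Word d (b i), ∑ β : ∀ i, Word d (b i), (∏ i, X (b i) (α i) (β i)) •
        (f (∏ i, ∏ j, t (α i j)) * 1 * star (f (∏ i, ∏ j, t (β i j)))) =
      iterTerm X T (List.ofFn b) := by
  intro n
  induction n with
  | zero => intro b; simp [iterTerm]
  | succ n ih =>
    intro b
    have ih := ih fun i => b i.succ
    rw [List.ofFn_succ, iterTerm, List.foldr_cons, ← iterTerm, ← ih]
    simp only [homTerm_sum, homTerm_smul]
    rw [← (Fin.consEquiv fun i => Word d (b i)).sum_comp, Fintype.sum_prod_type, Finset.sum_comm]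
    refine Finset.sum_congr rfl fun α _ => ?_
    simp_rw [← (Fin.consEquiv fun i => Word d (b i)).sum_comp, Fintype.sum_prod_type,
      Finset.sum_comm (s := (Finset.univ : Finset (Word d (b 0))))
        (t := (Finset.univ : Finset (∀ i : Fin n, Word d (b i.succ))))]
    refine Finset.sum_congr rfl fun β _ => ?_
    simp only [homTerm, Finset.smul_sum, smul_smul]
    refine Finset.sum_congr rfl fun α₀ _ => Finset.sum_congr rfl fun β₀ _ => ?_
    simp only [Fin.consEquiv, Equiv.coe_fn_mk, Fin.prod_univ_succ, Fin.cons_zero, Fin.cons_succ,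
      map_mul, star_mul, wordProd_eq_prod f ht, mul_assoc]
    rw [mul_comm]

/-- A word of length `k` is the same as a family of words on the blocks of `c`, and `T_α` is the
product of the corresponding block products. A tensor product of weights thus becomes a composition
of maps. -/
lemma homTerm_compMatrix (X : ∀ k : ℕ, WordMatrix d k) {T : Fin d → (H →L[ℂ] H)}
    (hT : ∀ i j, T i * T j = T j * T i) {k : ℕ} (c : Composition k) :
    homTerm (compMatrix X c) T T 1 = iterTerm X T c.blocks := by
  obtain ⟨A, _, f, t, ht⟩ := exists_commMonoid_hom hT
  rw [← c.ofFn_blocksFun, ← sum_pi_eq_iterTerm X f ht]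
  let e : Word d k ≃ (∀ i, Word d (c.blocksFun i)) :=
    (Equiv.arrowCongr c.blocksFinEquiv.symm (Equiv.refl _)).trans
      (Equiv.piCurry fun _ _ => Fin d)
  have he : ∀ α i, e α i = α ∘ c.embedding i := fun α i => rfl
  rw [homTerm, ← e.sum_comp]
  refine Finset.sum_congr rfl fun α _ => ?_
  rw [← e.sum_comp]
  refine Finset.sum_congr rfl fun β _ => ?_
  have h1 : ∀ α : Word d k, ∏ i, ∏ j, t (e α i j) = ∏ i, t (α i) := fun α =>
    c.prod_prod_apply_embedding fun i => t (α i)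
  rw [h1, h1, wordProd_eq_prod f ht, wordProd_eq_prod f ht]
  rfl

lemma iterTerm_nonneg {X : ∀ k : ℕ, WordMatrix d k} (hX : ∀ k, 1 ≤ k → (X k).PosSemidef)
    (T : Fin d → (H →L[ℂ] H)) (l : List ℕ) (hl : ∀ j ∈ l, 1 ≤ j) : 0 ≤ iterTerm X T l := by
  induction l with
  | nil => exact zero_le_one
  | cons j l ih =>
    exact homTerm_nonneg (hX j (hl j (by simp))) T (ih fun i hi => hl i (by simp [hi]))

/-- The left side is `Φ^l(1)` for the truncation `Φ(a) = ∑_{j ≤ N} T^{(j)} (X_j ⊗ a) T^{(j)*}`.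
Since `Φ` is linear and monotone, `Φ(r^l 1) = r^l Φ(1) ≤ r^{l+1} 1`. -/
lemma sum_iterTerm_le {X : ∀ k : ℕ, WordMatrix d k} (hX : ∀ k, 1 ≤ k → (X k).PosSemidef)
    (T : Fin d → (H →L[ℂ] H)) {r : ℝ} (hr : 0 ≤ r) (N : ℕ)
    (hT : ∑ j : Fin N, homTerm (X (j + 1)) T T 1 ≤ (r : ℂ) • 1) (l : ℕ) :
    ∑ b : Fin l → Fin N, iterTerm X T (List.ofFn fun i => (b i : ℕ) + 1) ≤ ((r ^ l : ℝ) : ℂ) • 1 := by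
  induction l with
  | zero => simp [iterTerm]
  | succ l ih =>
    have h1 : ∑ b : Fin (l + 1) → Fin N, iterTerm X T (List.ofFn fun i => (b i : ℕ) + 1) =
        ∑ j : Fin N, homTerm (X (j + 1)) T T
          (∑ b : Fin l → Fin N, iterTerm X T (List.ofFn fun i => (b i : ℕ) + 1)) := by
      rw [← (Fin.consEquiv fun _ => Fin N).sum_comp, Fintype.sum_prod_type]
      simp only [homTerm_sum]
      refine Finset.sum_congr rfl fun j _ => Finset.sum_congr rfl fun b _ => ?_
      simp [List.ofFn_succ, iterTerm, Fin.consEquiv]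
    rw [h1]
    refine (Finset.sum_le_sum fun j _ => homTerm_mono (hX _ (by omega)) T ih).trans ?_
    simp only [homTerm_smul, ← Finset.smul_sum]
    rw [le_iff_inner_le] at hT ⊢
    intro h
    have h2 := mul_le_mul_of_nonneg_left (hT h)
      (Complex.zero_le_real.mpr (pow_nonneg hr l) : (0 : ℂ) ≤ ((r ^ l : ℝ) : ℂ))
    simp only [smul_apply, inner_smul_right] at h2 ⊢
    refine h2.trans_eq ?_
    push_cast
    ring

/-- The left side is the sum of `iterTerm` over compositions of the numbers up to `N`. Such a
composition has at most `N` parts, each at most `N`, and all terms are positive, so the sum is at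
most `∑_{l ≤ N} Φ^l(1)` for the truncated `Φ`. -/
lemma sum_homTerm_Rsq_le {X : ∀ k : ℕ, WordMatrix d k} (hX : ∀ k, 1 ≤ k → (X k).PosSemidef)
    {T : Fin d → (H →L[ℂ] H)} (hc : ∀ i j, T i * T j = T j * T i) {r : ℝ} (hr : 0 ≤ r) (N : ℕ)
    (hT : ∑ j : Fin N, homTerm (X (j + 1)) T T 1 ≤ (r : ℂ) • 1) :
    ∑ k ∈ Finset.range (N + 1), homTerm (Rsq X k) T T 1 ≤
      ((∑ l ∈ Finset.range (N + 1), r ^ l : ℝ) : ℂ) • 1 := by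
  classical
  let S₁ : Finset (Σ k, Composition k) := (Finset.range (N + 1)).sigma fun _ => Finset.univ
  let S₂ : Finset (Σ l, Fin l → Fin N) := (Finset.range (N + 1)).sigma fun _ => Finset.univ
  let g : (Σ l, Fin l → Fin N) → List ℕ := fun b => List.ofFn fun i => (b.2 i : ℕ) + 1
  have hg : Function.Injective g := by
    rintro ⟨l, b⟩ ⟨l', b'⟩ h
    have hl : l = l' := by simpa [g] using congrArg List.length h
    subst hl
    have := List.ofFn_injective h
    congr 1
    funext i
    have := congrFun this i
    exact Fin.ext (by simpa using this)
  have h1 : ∑ k ∈ Finset.range (N + 1), homTerm (Rsq X k) T T 1 =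
      ∑ l ∈ S₁.image fun c => c.2.blocks, iterTerm X T l := by
    rw [Finset.sum_image fun c _ c' _ h => Composition.sigma_eq_iff_blocks_eq.mpr h,
      Finset.sum_sigma]
    refine Finset.sum_congr rfl fun k _ => ?_
    rw [Rsq_eq_sum, homTerm_matrix_sum]
    exact Finset.sum_congr rfl fun c _ => homTerm_compMatrix X hc c
  -- Parts are at least 1, while `Fin N` starts at 0; hence the shift by one in `g` and in the
  -- witness.
  have h2 : S₁.image (fun c => c.2.blocks) ⊆ S₂.image g := by
    intro l hl
    obtain ⟨⟨k, c⟩, hk, rfl⟩ := Finset.mem_image.mp hl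
    have hk' : k < N + 1 := by simpa [S₁] using hk
    have hle := c.length_le
    refine Finset.mem_image.mpr ⟨⟨c.length, fun i => ⟨c.blocksFun i - 1, ?_⟩⟩, ?_, ?_⟩
    · have := c.one_le_blocksFun i
      have := c.blocksFun_le i
      omega
    · simp only [S₂, Finset.mem_sigma, Finset.mem_range, Finset.mem_univ, and_true]
      omega
    · rw [← c.ofFn_blocksFun]
      refine congrArg List.ofFn (funext fun i => ?_)
      have := c.one_le_blocksFun i
      simp only
      omega
  rw [h1]
  refine (Finset.sum_le_sum_of_subset_of_nonneg h2 fun l hl _ => ?_).trans ?_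
  · obtain ⟨b, -, rfl⟩ := Finset.mem_image.mp hl
    refine iterTerm_nonneg hX T _ fun j hj => ?_
    obtain ⟨i, rfl⟩ := List.mem_ofFn.mp hj
    omega
  · rw [Finset.sum_image fun b _ b' _ h => hg h, Finset.sum_sigma]
    push_cast
    rw [Finset.sum_smul]
    refine Finset.sum_le_sum fun l _ => ?_
    exact_mod_cast sum_iterTerm_le hX T hr N hT l

/-- The rows of `(R_k ⊗ I) T^{(k)*}`, `k ≥ 0`, for `T ∈ D_c(X, H)` are square summable. -/
lemma exists_rowOp_bound {X : ∀ k : ℕ, WordMatrix d k} (hX : ∀ k, 1 ≤ k → (X k).PosSemidef)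
    (T : commDomain X H) : ∃ C : ℝ, ∀ (s : Finset (Σ k, Word d k)) (h : H),
      ∑ i ∈ s, ‖rowOp (Rmat X i.1) T.1 i.2 h‖ ^ 2 ≤ C * ‖h‖ ^ 2 := by
  classical
  obtain ⟨T, hc, P, hP, hP1⟩ := T
  -- The terms are positive, so partial sums are at most `P`, and `P ≤ ‖P‖ 1`.
  have hN : ∀ N, ∑ j : Fin N, homTerm (X (j + 1)) T T 1 ≤ ((‖P‖ : ℝ) : ℂ) • 1 := fun N => by
    rw [le_iff_inner_le]
    intro h
    have h1 : HasSum (fun k => ⟪h, homTerm (X (k + 1)) T T 1 h⟫_ℂ) ⟪h, P h⟫_ℂ := by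
      have := ContinuousLinearMapWOT.tendsto_iff_forall_inner_apply_tendsto.mp hP h h
      refine this.congr fun s => ?_
      rw [← inner_sum]
      congr 1
      induction s using Finset.induction_on with
      | empty => rfl
      | insert i s hi ih =>
        rw [Finset.sum_insert hi, Finset.sum_insert hi, ← ih]; rfl
    have h2 := sum_le_hasSum (Finset.range N) (fun k _ =>
      ((ContinuousLinearMap.nonneg_iff_isPositive _).mp
        (homTerm_nonneg (hX (k + 1) (by omega)) T zero_le_one)).inner_nonneg_right h) h1
    rw [← Fin.sum_univ_eq_sum_range (fun k => ⟪h, homTerm (X (k + 1)) T T 1 h⟫_ℂ)] at h2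
    rw [_root_.sum_apply, inner_sum]
    refine h2.trans ?_
    have h0 : (0 : ℂ) ≤ ⟪h, P h⟫_ℂ := h1.nonneg fun k =>
      ((ContinuousLinearMap.nonneg_iff_isPositive _).mp
        (homTerm_nonneg (hX (k + 1) (by omega)) T zero_le_one)).inner_nonneg_right h
    have h3 : ⟪h, P h⟫_ℂ = ((‖⟪h, P h⟫_ℂ‖ : ℝ) : ℂ) := (Complex.norm_of_nonneg' h0).symm
    rw [h3, smul_apply, inner_smul_right, one_apply_eq_self, inner_self_eq_ofReal,
      ← Complex.ofReal_mul, Complex.real_le_real]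
    calc _ ≤ ‖h‖ * ‖P h‖ := norm_inner_le_norm _ _
      _ ≤ ‖h‖ * (‖P‖ * ‖h‖) := by gcongr; exact P.le_opNorm h
      _ = _ := by ring
  -- The sum of the geometric series `∑ ‖P‖^l`; a finite set of words has bounded length, so the
  -- truncated estimate suffices.
  refine ⟨(1 - ‖P‖)⁻¹, fun s h => ?_⟩
  obtain ⟨N, hsN⟩ : ∃ N, ∀ i ∈ s, i.1 ≤ N :=
    ⟨s.sup Sigma.fst, fun i hi => Finset.le_sup (f := Sigma.fst) hi⟩
  have h1 := le_iff_inner_le.mp (sum_homTerm_Rsq_le hX hc (norm_nonneg P) N (hN N)) h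
  have h2 : ∀ k, ⟪h, homTerm (Rsq X k) T T 1 h⟫_ℂ =
      ((∑ γ, ‖rowOp (Rmat X k) T γ h‖ ^ 2 : ℝ) : ℂ) := fun k => by
    rw [← Rmat_mul_self hX, homTerm_conjTranspose_mul, _root_.sum_apply, inner_sum,
      Complex.ofReal_sum]
    refine Finset.sum_congr rfl fun γ _ => ?_
    rw [mul_one, mul_apply_eq_comp, ContinuousLinearMap.star_eq_adjoint,
      ContinuousLinearMap.adjoint_inner_right, inner_self_eq_ofReal]
  rw [_root_.sum_apply, inner_sum] at h1
  simp only [h2, smul_apply, inner_smul_right, one_apply_eq_self, inner_self_eq_ofReal,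
    ← Complex.ofReal_mul, ← Complex.ofReal_sum, Complex.real_le_real] at h1
  calc _ ≤ ∑ i ∈ (Finset.range (N + 1)).sigma fun k => (Finset.univ : Finset (Word d k)),
        ‖rowOp (Rmat X i.1) T i.2 h‖ ^ 2 := by
        refine Finset.sum_le_sum_of_subset_of_nonneg (fun i hi => ?_) fun i _ _ => by positivity
        simpa using Nat.lt_succ_of_le (hsN i hi)
    _ ≤ (∑ l ∈ Finset.range (N + 1), ‖P‖ ^ l) * ‖h‖ ^ 2 := by
        rw [Finset.sum_sigma]; exact h1
    _ ≤ (1 - ‖P‖)⁻¹ * ‖h‖ ^ 2 := by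
        gcongr
        rw [← tsum_geometric_of_lt_one (norm_nonneg P) hP1]
        exact (summable_geometric_of_lt_one (norm_nonneg P) hP1).sum_le_tsum _
          fun l _ => by positivity

end HomTerm

/-! ### Flattening a Hilbert sum of finite-dimensional coordinate spaces -/

section Flatten

variable {ι : Type*} {W : ι → Type*} [∀ k, Fintype (W k)]

lemma memlp_flatten (f : lp (fun k => EuclideanSpace ℂ (W k)) 2) :
    Memℓp (fun i : Σ k, W k => f i.1 i.2) 2 := by
  rw [memlp_two_iff, summable_sigma_of_nonneg fun i => by positivity]
  refine ⟨fun k => Summable.of_finite, ?_⟩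
  refine (lp_norm_sq f).summable.congr fun k => ?_
  rw [tsum_fintype, EuclideanSpace.norm_sq_eq]

lemma memlp_unflatten (g : HilbSum (Σ k, W k) ℂ) :
    Memℓp (E := fun k => EuclideanSpace ℂ (W k)) (fun k => WithLp.toLp 2 fun γ => g ⟨k, γ⟩) 2 := by
  rw [memlp_two_iff]
  have := (summable_sigma_of_nonneg (fun i => by positivity)).mp (lp_norm_sq g).summable
  refine this.2.congr fun k => ?_
  rw [tsum_fintype, EuclideanSpace.norm_sq_eq]

/-- `⊕_k ℂ^{W_k}` is `ℓ²` of the disjoint union of the `W_k`. -/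
def flatten : lp (fun k => EuclideanSpace ℂ (W k)) 2 ≃ₗᵢ[ℂ] HilbSum (Σ k, W k) ℂ where
  toFun f := ⟨fun i => f i.1 i.2, memlp_flatten f⟩
  invFun g := ⟨fun k => WithLp.toLp 2 fun γ => g ⟨k, γ⟩, memlp_unflatten g⟩
  map_add' f g := by ext; rfl
  map_smul' c f := by ext; rfl
  left_inv f := by ext; rfl
  right_inv g := by ext; rfl
  norm_map' f := by
    have h1 := lp_norm_sq (⟨fun i => f i.1 i.2, memlp_flatten f⟩ : HilbSum (Σ k, W k) ℂ)
    have h2 := h1.sigma fun k => hasSum_fintype _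
    have h3 := h2.unique ((lp_norm_sq f).congr_fun fun k => by rw [EuclideanSpace.norm_sq_eq])
    exact (sq_eq_sq₀ (norm_nonneg _) (norm_nonneg _)).mp h3

lemma flatten_symm_apply (g : HilbSum (Σ k, W k) ℂ) (k : ι) (γ : W k) :
    flatten.symm g k γ = g ⟨k, γ⟩ := rfl

end Flatten

/-! ### Symmetric tensors and homogeneous polynomials -/

section Symmetric

variable {d : ℕ}

/-- The number of occurrences of each letter in a word. -/
def wordType {k : ℕ} (α : Word d k) : Fin d →₀ ℕ := ∑ i, Finsupp.single (α i) 1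

/-- For each letter the two sets of positions have equal size; bijections between them are glued
along the fibres. -/
lemma exists_perm_of_wordType_eq {k : ℕ} {α β : Word d k} (h : wordType α = wordType β) :
    ∃ π : Equiv.Perm (Fin k), β ∘ π = α := by
  have hc : ∀ (α : Word d k) a, wordType α a = Fintype.card {i // α i = a} := fun α a => by
    simp [wordType, Finsupp.single_apply, Fintype.card_subtype]
  have e : ∀ a, Nonempty ({i // α i = a} ≃ {i // β i = a}) := fun a =>
    ⟨Fintype.equivOfCardEq (by rw [← hc, ← hc, h])⟩
  have e := fun a => (e a).some
  refine ⟨((Equiv.sigmaFiberEquiv α).symm.trans (Equiv.sigmaCongrRight e)).trans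
    (Equiv.sigmaFiberEquiv β), funext fun i => ?_⟩
  exact (e (α i) ⟨i, rfl⟩).2

/-- A polynomial vanishing at every point is zero, so the entries of `w` sum to zero over the words
of each type. A symmetric tensor is constant on each type, so its inner product with `w` collects
exactly these sums. -/
lemma sum_eq_zero_of_symm {k : ℕ} (w : Word d k → ℂ)
    (hw : ∀ z : Fin d → ℂ, ∑ α, (∏ i, z (α i)) * w α = 0) (s : TensorPow d k)
    (hs : s ∈ symPow d k) : ⟪s, (WithLp.toLp 2 w : TensorPow d k)⟫_ℂ = 0 := by
  classical
  have hp : (∑ α, MvPolynomial.monomial (wordType α) (w α) : MvPolynomial (Fin d) ℂ) = 0 := by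
    refine MvPolynomial.funext fun z => ?_
    rw [map_zero, map_sum, ← hw z]
    refine Finset.sum_congr rfl fun α _ => ?_
    rw [MvPolynomial.eval_monomial, mul_comm]
    congr 1
    rw [wordType, ← Finsupp.prod_finsetSum_index] <;> simp [pow_add]
  have hm : ∀ m, ∑ α ∈ Finset.univ.filter (fun α : Word d k => wordType α = m), w α = 0 := fun m => by
    have := congrArg (MvPolynomial.coeff m) hp
    simpa [MvPolynomial.coeff_sum, MvPolynomial.coeff_monomial, Finset.sum_filter] using this
  rw [PiLp.inner_apply]
  rw [← Finset.sum_fiberwise_of_maps_to (t := Finset.univ.image fun α : Word d k => wordType α)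
    fun α _ => Finset.mem_image_of_mem _ (Finset.mem_univ α)]
  refine Finset.sum_eq_zero fun m hmem => ?_
  obtain ⟨β, -, rfl⟩ := Finset.mem_image.mp hmem
  have : ∀ α ∈ Finset.univ.filter (fun α : Word d k => wordType α = wordType β),
      ⟪s α, (WithLp.toLp 2 w : TensorPow d k) α⟫_ℂ = (starRingEnd ℂ) (s β) * w α := fun α hα => by
    obtain ⟨π, hπ⟩ := exists_perm_of_wordType_eq (Finset.mem_filter.mp hα).2
    rw [← hπ, hs π β, RCLike.inner_apply, mul_comm]
  rw [Finset.sum_congr rfl this, ← Finset.mul_sum, hm, mul_zero]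

lemma eq_zero_of_hasSum_pow {c : ℕ → ℂ}
    (h : ∀ᶠ t : ℂ in nhds 0, HasSum (fun k => t ^ k * c k) 0) (k : ℕ) : c k = 0 := by
  let p : FormalMultilinearSeries ℂ ℂ ℂ := fun n => ContinuousMultilinearMap.mkPiRing ℂ (Fin n) (c n)
  have hp : HasFPowerSeriesAt 0 p 0 := by
    rw [hasFPowerSeriesAt_iff]
    refine h.mono fun t ht => ?_
    simpa [p, FormalMultilinearSeries.coeff] using ht
  have := congrArg (fun q => FormalMultilinearSeries.coeff q k) hp.eq_zero
  simpa [p, FormalMultilinearSeries.coeff] using this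

end Symmetric

/-! ### Small scalar tuples -/

section Scalar

variable {d : ℕ} {X : ∀ k : ℕ, WordMatrix d k}

lemma Admissible.exists_norm_le (hX : Admissible X) :
    ∃ C : ℝ, 1 ≤ C ∧ ∀ k, 1 ≤ k → ‖wordOp (X k)‖ ≤ C ^ k := by
  obtain ⟨c, hc, -⟩ := ENNReal.lt_iff_exists_nnreal_btwn.mp hX.limsup_lt
  obtain ⟨K, hK⟩ := Filter.eventually_atTop.mp (Filter.eventually_lt_of_limsup_lt hc)
  have hnn : 0 ≤ ∑ j ∈ Finset.range K, ‖wordOp (X j)‖ := Finset.sum_nonneg fun _ _ => norm_nonneg _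
  have hc0 : (0 : ℝ) ≤ c := c.2
  -- The root test bounds the tail by `c^k` and the sum covers the finitely many indices below `K`;
  -- the summand 1 makes the base at least 1, so that powers dominate it.
  refine ⟨c + 1 + ∑ j ∈ Finset.range K, ‖wordOp (X j)‖, by linarith, fun k hk => ?_⟩
  rcases lt_or_ge k K with h | h
  · have h1 := Finset.single_le_sum (f := fun j => ‖wordOp (X j)‖) (fun _ _ => norm_nonneg _)
      (Finset.mem_range.mpr h)
    calc ‖wordOp (X k)‖ ≤ c + 1 + ∑ j ∈ Finset.range K, ‖wordOp (X j)‖ := by linarith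
      _ ≤ _ := le_self_pow₀ (by linarith) (by omega)
  · have h1 := hK k h
    have hk0 : (k : ℝ) ≠ 0 := by positivity
    have h2 : ‖wordOp (X k)‖ ^ (1 / (k : ℝ)) < c := by
      have := (ENNReal.ofReal_lt_iff_lt_toReal (by positivity) (by simp)).mp h1
      simpa using this
    calc ‖wordOp (X k)‖ = (‖wordOp (X k)‖ ^ (1 / (k : ℝ))) ^ k := by
          rw [← Real.rpow_natCast, ← Real.rpow_mul (norm_nonneg _), one_div_mul_cancel hk0,
            Real.rpow_one]
      _ ≤ _ := by gcongr; linarith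

variable {H : Type u} [NormedAddCommGroup H] [InnerProductSpace ℂ H] [CompleteSpace H]

/-- The tuple of scalar operators `z_i I`. -/
def scalarTuple (H : Type u) [NormedAddCommGroup H] [InnerProductSpace ℂ H] (z : Fin d → ℂ) :
    Fin d → (H →L[ℂ] H) := fun i => z i • 1

lemma wordProd_scalarTuple (z : Fin d → ℂ) {k : ℕ} (α : Word d k) :
    wordProd (scalarTuple H z) α = (∏ i, z (α i)) • 1 := by
  let f : ℂ →* (H →L[ℂ] H) := (algebraMap ℂ (H →L[ℂ] H)).toMonoidHom
  have hf : ∀ c, f c = c • 1 := fun c => Algebra.algebraMap_eq_smul_one c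
  rw [wordProd_eq_prod f (t := z) (T := scalarTuple H z) fun i => hf (z i), hf]

/-- At a scalar tuple the term is the scalar `⟨u, M u⟩` with `u = z̄^{⊗k}`, and `‖u‖² = (∑
|z_i|²)^k`. -/
lemma norm_homTerm_scalarTuple_le (z : Fin d → ℂ) {k : ℕ} (M : WordMatrix d k) :
    ‖homTerm M (scalarTuple H z) (scalarTuple H z) 1‖ ≤ ‖wordOp M‖ * (∑ i, ‖z i‖ ^ 2) ^ k := by
  let u : TensorPow d k := WithLp.toLp 2 fun α => (starRingEnd ℂ) (∏ i, z (α i))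
  have h1 : homTerm M (scalarTuple H z) (scalarTuple H z) 1 = ⟪u, wordOp M u⟫_ℂ • 1 := by
    rw [PiLp.inner_apply]
    simp only [homTerm, wordProd_scalarTuple, Finset.sum_smul]
    refine Finset.sum_congr rfl fun α _ => ?_
    have : wordOp M u α = ∑ β, M α β * u β := by
      rw [wordOp, Matrix.ofLp_toEuclideanCLM]; rfl
    rw [this, RCLike.inner_apply, Finset.sum_mul, Finset.sum_smul]
    refine Finset.sum_congr rfl fun β _ => ?_
    simp only [star_smul, star_one, smul_mul_assoc, mul_smul_comm, mul_one, smul_smul, u,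
      Complex.conj_conj]
    congr 1
    simp only [starRingEnd_apply]
    ring
  have h2 : ‖u‖ ^ 2 = (∑ i, ‖z i‖ ^ 2) ^ k := by
    rw [EuclideanSpace.norm_sq_eq, Fintype.sum_pow]
    refine Finset.sum_congr rfl fun α _ => ?_
    simp [u, Finset.prod_pow]
  rw [h1]
  have h3 : ‖(1 : H →L[ℂ] H)‖ ≤ 1 := ContinuousLinearMap.norm_id_le
  calc _ ≤ ‖⟪u, wordOp M u⟫_ℂ‖ * ‖(1 : H →L[ℂ] H)‖ := norm_smul_le _ _
    _ ≤ ‖⟪u, wordOp M u⟫_ℂ‖ * 1 := by gcongr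
    _ ≤ ‖u‖ * (‖wordOp M‖ * ‖u‖) := by
        rw [mul_one]
        exact (norm_inner_le_norm _ _).trans (by gcongr; exact (wordOp M).le_opNorm u)
    _ = _ := by rw [← h2]; ring

/-- The terms are dominated by `q^{k+1}`, so the norm of the sum is at most `q / (1 - q)`; the bound
`q ≤ 1/3` keeps this at most `1/2`. -/
lemma scalarTuple_mem_commDomain {C : ℝ} (hC : ∀ k, 1 ≤ k → ‖wordOp (X k)‖ ≤ C ^ k)
    (hC1 : 1 ≤ C) {z : Fin d → ℂ} (hz : C * ∑ i, ‖z i‖ ^ 2 ≤ 1 / 3) :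
    scalarTuple H z ∈ commDomain X H := by
  refine ⟨fun i j => by simp [scalarTuple, smul_smul, mul_comm], ?_⟩
  set q := C * ∑ i, ‖z i‖ ^ 2 with hq
  have hq0 : 0 ≤ q := mul_nonneg (by linarith) (Finset.sum_nonneg fun _ _ => by positivity)
  have hle : ∀ k, ‖homTerm (X (k + 1)) (scalarTuple H z) (scalarTuple H z) 1‖ ≤ q * q ^ k :=
    fun k => by
      refine (norm_homTerm_scalarTuple_le z _).trans ?_
      rw [← pow_succ', hq, mul_pow]
      gcongr
      exact hC _ (by omega)
  have hs : HasSum (fun k => q * q ^ k) (q * (1 - q)⁻¹) :=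
    (hasSum_geometric_of_lt_one hq0 (by linarith)).mul_left q
  have hsum : Summable fun k => homTerm (X (k + 1)) (scalarTuple H z) (scalarTuple H z) 1 :=
    Summable.of_norm_bounded hs.summable hle
  refine ⟨_, (ContinuousLinearMap.WOTofCLM (𝕜₂ := ℂ) (σ := RingHom.id ℂ) (E := H)
    (F := H)).hasSum hsum.hasSum, ?_⟩
  refine (tsum_of_norm_bounded hs hle).trans_lt ?_
  rw [← div_eq_mul_inv, div_lt_one (by linarith)]
  linarith

end Scalar

/-! ### The kernel `K^R_c` and the space `F(R)` -/

section Main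

variable {H : Type u} [NormedAddCommGroup H] [InnerProductSpace ℂ H] [CompleteSpace H] {d : ℕ}
  {X : ∀ k : ℕ, WordMatrix d k}

/-- The operator `h ↦ ((R_k ⊗ I) V^{(k)*} h)_k`. -/
def domainCol (hX : Admissible X) (V : commDomain X H) : H →L[ℂ] HilbSum (Σ k, Word d k) H :=
  lpCol (fun i => rowOp (Rmat X i.1) V.1 i.2) (exists_rowOp_bound hX.posSemidef V).choose
    (exists_rowOp_bound hX.posSemidef V).choose_spec

lemma domainCol_apply (hX : Admissible X) (V : commDomain X H) (h : H) (i : Σ k, Word d k) :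
    domainCol hX V h i = rowOp (Rmat X i.1) V.1 i.2 h := rfl

/-- The inner product in `ℓ²(words) ⊗ H`, summed over words of each length first, is the kernel
series: the block of length `k` is its `k`-th term because `R_k* R_k = R_k²`. -/
lemma hasSum_kernelTerm (hX : Admissible X) (V W : commDomain X H) (a : H →L[ℂ] H) :
    HasSum (kernelTerm X V W a)
      (ofCLM (ContinuousLinearMap.adjoint (domainCol hX V) ∘L lpMap a ∘L domainCol hX W)) := by
  classical
  refine ContinuousLinearMapWOT.tendsto_iff_forall_inner_apply_tendsto.mpr fun x y => ?_
  have h1 : HasSum (fun k => ∑ γ : Word d k,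
      ⟪domainCol hX V y ⟨k, γ⟩, lpMap a (domainCol hX W x) ⟨k, γ⟩⟫_ℂ)
      ⟪domainCol hX V y, lpMap a (domainCol hX W x)⟫_ℂ :=
    HasSum.sigma (lp.hasSum_inner (𝕜 := ℂ) _ _) fun k => hasSum_fintype _
  have h2 : ∀ k, ∑ γ : Word d k, ⟪domainCol hX V y ⟨k, γ⟩, lpMap a (domainCol hX W x) ⟨k, γ⟩⟫_ℂ =
      ⟪y, kernelTerm X V W a k x⟫_ℂ := fun k => by
    rw [kernelTerm, ContinuousLinearMapWOT.ofCLM_apply, ← Rmat_mul_self hX.posSemidef,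
      homTerm_conjTranspose_mul, _root_.sum_apply, inner_sum]
    refine Finset.sum_congr rfl fun γ _ => ?_
    rw [mul_apply_eq_comp, mul_apply_eq_comp, ContinuousLinearMap.star_eq_adjoint,
      ContinuousLinearMap.adjoint_inner_right]
    rfl
  simp only [h2] at h1
  rw [ContinuousLinearMapWOT.ofCLM_apply, ContinuousLinearMap.comp_apply,
    ContinuousLinearMap.adjoint_inner_right]
  refine h1.congr fun s => ?_
  rw [← inner_sum]
  congr 1
  induction s using Finset.induction_on with
  | empty => rfl
  | insert i s hi ih =>
    rw [Finset.sum_insert hi, Finset.sum_insert hi, ih]; rfl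

lemma kernelRc_eq (hX : Admissible X) (V W : commDomain X H) (a : H →L[ℂ] H) :
    kernelRc X H V W a =
      ContinuousLinearMap.adjoint (domainCol hX V) ∘L lpMap a ∘L domainCol hX W := by
  rw [kernelRc, (hasSum_kernelTerm hX V W a).tsum_eq]

lemma isClosed_weightedFock (X : ∀ k : ℕ, WordMatrix d k) :
    IsClosed (weightedFock X : Set (FullFock d)) := by
  have h : (weightedFock X : Set (FullFock d)) =
      ⋂ k, (fun f : FullFock d => f k) ⁻¹' ((symPow d k).map (Rop X k).toLinearMap) := by
    ext f; simp [weightedFock]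
  rw [h]
  refine isClosed_iInter fun k => (Submodule.closed_of_finiteDimensional _).preimage ?_
  exact (lp.evalCLM ℂ (fun k => TensorPow d k) 2 k).continuous

/-- `F(R)` inside `ℓ²` of the set of all words. -/
def flatFock (X : ∀ k : ℕ, WordMatrix d k) : Submodule ℂ (HilbSum (Σ k, Word d k) ℂ) :=
  (weightedFock X).map (flatten (W := Word d)).toLinearEquiv.toLinearMap

lemma mem_flatFock {ξ : HilbSum (Σ k, Word d k) ℂ} :
    ξ ∈ flatFock X ↔ flatten.symm ξ ∈ weightedFock X := by
  constructor
  · rintro ⟨f, hf, rfl⟩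
    exact (flatten.symm_apply_apply f).symm ▸ hf
  · exact fun h => ⟨_, h, flatten.apply_symm_apply ξ⟩

lemma isClosed_flatFock (X : ∀ k : ℕ, WordMatrix d k) :
    IsClosed (flatFock X : Set (HilbSum (Σ k, Word d k) ℂ)) := by
  have h : (flatFock X : Set (HilbSum (Σ k, Word d k) ℂ)) =
      flatten.symm ⁻¹' (weightedFock X : Set (FullFock d)) := Set.ext fun ξ => mem_flatFock
  rw [h]
  exact (isClosed_weightedFock X).preimage flatten.symm.continuous

lemma slice_mem_flatFock (hX : Admissible X) (V : commDomain X H) (e h : H) :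
    lpMap (innerSL ℂ e) (domainCol hX V h) ∈ flatFock X := by
  rw [mem_flatFock]
  intro k
  -- Commutativity of `V` makes this tensor symmetric, by `wordProd_comp_perm`; applying `R_k` to it
  -- gives the slice.
  refine ⟨WithLp.toLp 2 fun α => ⟪e, star (wordProd V.1 α) h⟫_ℂ, fun π α => ?_, ?_⟩
  · change ⟪e, star (wordProd V.1 (α ∘ π)) h⟫_ℂ = ⟪e, star (wordProd V.1 α) h⟫_ℂ
    rw [wordProd_comp_perm V.2.1]
  · ext γ
    refine (Rop_apply X k _ γ).trans ?_
    rw [flatten_symm_apply, lpMap_apply, innerSL_apply_apply, domainCol_apply, rowOp,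
      _root_.sum_apply, inner_sum]
    refine Finset.sum_congr rfl fun α _ => ?_
    rw [smul_apply, inner_smul_right]

/-- The coefficient sequence `⊕_k R_k z̄^{⊗k}` of the point `z` of the scalar domain. -/
lemma exists_scalar_coeff [Nontrivial H] (hX : Admissible X) (z : Fin d → ℂ)
    (hz : scalarTuple H z ∈ commDomain X H) :
    ∃ ξ ∈ flatFock X, (∀ h, domainCol hX ⟨scalarTuple H z, hz⟩ h = tensorVec ξ h) ∧
      ∀ k, flatten.symm ξ k =
        Rop X k (WithLp.toLp 2 fun α => (starRingEnd ℂ) (∏ i, z (α i))) := by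
  obtain ⟨e, he⟩ := exists_norm_eq H zero_le_one
  have hrow : ∀ (k : ℕ) (γ : Word d k) (h : H), rowOp (Rmat X k) (scalarTuple H z) γ h =
      (∑ α, Rmat X k γ α * (starRingEnd ℂ) (∏ i, z (α i))) • h := fun k γ h => by
    simp only [rowOp, wordProd_scalarTuple, _root_.sum_apply, Finset.sum_smul, star_smul, star_one,
      smul_apply, one_apply_eq_self, smul_smul]
    rfl
  have hξ : ∀ i : Σ k, Word d k,
      lpMap (innerSL ℂ e) (domainCol hX ⟨scalarTuple H z, hz⟩ e) i =
        ∑ α, Rmat X i.1 i.2 α * (starRingEnd ℂ) (∏ j, z (α j)) := fun i => by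
    rw [lpMap_apply, domainCol_apply, hrow, innerSL_apply_apply, inner_smul_right,
      inner_self_eq_ofReal, he]
    simp
  refine ⟨_, slice_mem_flatFock hX ⟨scalarTuple H z, hz⟩ e e, fun h => ?_, fun k => ?_⟩
  · ext i
    rw [tensorVec_apply, hξ, domainCol_apply, hrow]
  · ext γ
    rw [flatten_symm_apply, hξ, Rop_apply]

/-- An element of `F(R)` orthogonal to all coefficient sequences of small scalar points is zero. -/
lemma eq_zero_of_orthogonal (f : FullFock d) (hf : f ∈ weightedFock X) {ε : ℝ} (hε : 0 < ε)
    (h : ∀ z : Fin d → ℂ, ∑ i, ‖z i‖ ^ 2 ≤ ε → HasSum (fun k =>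
      ⟪Rop X k (WithLp.toLp 2 fun α => (starRingEnd ℂ) (∏ i, z (α i))), f k⟫_ℂ) 0) : f = 0 := by
  have hinner : ∀ (k : ℕ) (z : Fin d → ℂ),
      ⟪Rop X k (WithLp.toLp 2 fun α => (starRingEnd ℂ) (∏ i, z (α i))), f k⟫_ℂ =
        ∑ α, (∏ i, z (α i)) * Rop X k (f k) α := fun k z => by
    rw [Rop_adj, PiLp.inner_apply]
    refine Finset.sum_congr rfl fun α _ => ?_
    rw [RCLike.inner_apply, Complex.conj_conj, mul_comm]
  have hpoly : ∀ (z : Fin d → ℂ) (k : ℕ), ∑ α, (∏ i, z (α i)) * Rop X k (f k) α = 0 := by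
    intro z
    refine eq_zero_of_hasSum_pow ?_
    -- For fixed `z` the points `t z` with `t` near 0 satisfy the smallness condition, and the
    -- degree `k` term scales by `t^k`. Uniqueness of power series then separates the degrees, for
    -- every `z`.
    have hlim : Filter.Tendsto (fun t : ℂ => ∑ i, ‖t * z i‖ ^ 2) (nhds 0) (nhds 0) := by
      have : Continuous fun t : ℂ => ∑ i, ‖t * z i‖ ^ 2 := by fun_prop
      simpa using this.tendsto 0
    filter_upwards [hlim.eventually_le_const hε] with t ht
    refine (h (fun i => t * z i) ht).congr_fun fun k => ?_
    refine Eq.trans ?_ (hinner k fun i => t * z i).symm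
    rw [Finset.mul_sum]
    refine Finset.sum_congr rfl fun α _ => ?_
    rw [Finset.prod_mul_distrib, Finset.prod_const, Finset.card_univ, Fintype.card_fin, mul_assoc]
  ext1
  funext k
  obtain ⟨s, hs, hsf⟩ := hf k
  have h1 := sum_eq_zero_of_symm (fun α => Rop X k (f k) α) (fun z => hpoly z k) s hs
  -- Write `f_k = R_k s` with `s` symmetric: `‖f_k‖² = ⟨s, R_k f_k⟩`, which vanishes although `R_k
  -- f_k` itself need not be symmetric.
  have h2 : ⟪f k, f k⟫_ℂ = 0 := by
    nth_rewrite 1 [← hsf]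
    exact (Rop_adj X k s (f k)).trans h1
  exact inner_self_eq_zero.mp h2

/-- An element of `F(R)` is split along the closed span `C` and its orthogonal complement. The
orthogonal part is again in `F(R)` and is orthogonal to all coefficient sequences of small scalar
points, hence zero. -/
lemma flatFock_le_closure_span [Nontrivial H] (hX : Admissible X) :
    flatFock X ≤ (Submodule.span ℂ {ξ | ∃ w : commDomain X H, ∀ h,
      domainCol hX w h = tensorVec ξ h}).topologicalClosure := by
  set S : Set (HilbSum (Σ k, Word d k) ℂ) :=
    {ξ | ∃ w : commDomain X H, ∀ h, domainCol hX w h = tensorVec ξ h} with hS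
  obtain ⟨e, he⟩ := exists_norm_eq H zero_le_one
  -- The reverse inclusion is what keeps the orthogonal part inside `F(R)`.
  have hle : (Submodule.span ℂ S).topologicalClosure ≤ flatFock X := by
    refine Submodule.topologicalClosure_minimal _ (Submodule.span_le.mpr ?_) (isClosed_flatFock X)
    rintro ξ ⟨w, hw⟩
    have h1 := slice_mem_flatFock hX w e e
    have h2 : lpMap (innerSL ℂ e) (tensorVec ξ e) = ξ := by
      ext i; simp [inner_smul_right, he]
    rwa [hw, h2] at h1
  intro f hf
  set C := (Submodule.span ℂ S).topologicalClosure with hC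
  have : CompleteSpace C := (Submodule.isClosed_topologicalClosure _).completeSpace_coe
  obtain ⟨p, hp, q, hq, rfl⟩ := C.exists_add_mem_mem_orthogonal f
  have hqM : q ∈ flatFock X := by
    have := (flatFock X).sub_mem hf (hle hp)
    rwa [add_sub_cancel_left] at this
  obtain ⟨B, hB1, hB⟩ := hX.exists_norm_le
  have hq0 : flatten.symm q = 0 := by
    -- The radius is chosen so that `B ∑ |z_i|² ≤ 1/3`, the condition for scalar tuples to lie in
    -- the domain.
    refine eq_zero_of_orthogonal _ (mem_flatFock.mp hqM) (ε := 1 / 3 / B) (by positivity)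
      fun z hz => ?_
    have hz' : scalarTuple H z ∈ commDomain X H := scalarTuple_mem_commDomain hB hB1 (by
      rw [le_div_iff₀ (by linarith)] at hz; linarith)
    obtain ⟨ξ, -, hξ, hξR⟩ := exists_scalar_coeff hX z hz'
    have h1 : ⟪ξ, q⟫_ℂ = 0 := hq ξ
      (Submodule.le_topologicalClosure _ (Submodule.subset_span ⟨⟨_, hz'⟩, hξ⟩))
    rw [← flatten.symm.inner_map_map] at h1
    have h2 := lp.hasSum_inner (𝕜 := ℂ) (flatten.symm ξ) (flatten.symm q)
    rw [h1] at h2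
    simpa only [hξR] using h2
  have : q = 0 := (LinearIsometryEquiv.map_eq_zero_iff _).mp hq0
  rw [this, add_zero]
  exact hp

end Main

end RKC

end

/-- For an admissible sequence `X`, the series of the kernel `K^R_c` converge, `K^R_c` is a completely
positive kernel, and the `σ`-dual of its reproducing kernel correspondence is isomorphic, as a
Hilbert space, to `F(R)`: the inner product `⟨Y, Z⟩ = Y* Z` of the `σ`-dual has scalar values
(multiples of the identity), and `Ψ` is a linear bijection that preserves inner products. -/
theorem proposition5p5 {d : ℕ} (hd : 0 < d) (X : ∀ k : ℕ, RKC.WordMatrix d k)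
    (hX : RKC.Admissible X) (H : Type*) [NormedAddCommGroup H] [InnerProductSpace ℂ H]
    [CompleteSpace H] [Nontrivial H] :
    (∀ (V W : RKC.commDomain X H) (a : H →L[ℂ] H), Summable (RKC.kernelTerm X V W a)) ∧
    ∃ hK : RKC.IsCPKernel (RKC.kernelRc X H),
      ∃ Ψ : RKC.weightedFock X ≃ₗ[ℂ] (RKC.rkCorr hK).sigmaDual,
        ∀ ξ η : RKC.weightedFock X,
          (RKC.rkCorr hK).sigmaDualInner (Ψ ξ) (Ψ η) = ⟪ξ, η⟫_ℂ • ContinuousLinearMap.id ℂ H := by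
  have hL := RKC.kernelRc_eq (H := H) hX
  refine ⟨fun V W a => (RKC.hasSum_kernelTerm hX V W a).summable,
    RKC.isCPKernel_of_factored hL, ?_⟩
  obtain ⟨Ψ, hΨ⟩ := RKC.exists_sigmaDual_equiv (RKC.isCPKernel_of_factored hL) hL (RKC.flatFock X)
    (RKC.isClosed_flatFock X) (RKC.slice_mem_flatFock hX) (RKC.flatFock_le_closure_span hX)
  -- The σ-dual was computed in `ℓ²` of all words; `flatten` carries `F(R)` there unitarily.
  let φ : RKC.weightedFock X ≃ₗ[ℂ] RKC.flatFock X :=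
    (RKC.flatten (W := RKC.Word d)).toLinearEquiv.submoduleMap (RKC.weightedFock X)
  refine ⟨φ.trans Ψ, fun ξ η => ?_⟩
  have h : ⟪φ ξ, φ η⟫_ℂ = ⟪ξ, η⟫_ℂ := RKC.flatten.inner_map_map ξ.1 η.1
  rw [← h]
  exact hΨ (φ ξ) (φ η)
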